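/- Let $V$ be a finite-dimensional Euclidean vector space and let $W\subset \mathrm{O}(V)$ be a finite reflection group that is almost irreducible, i.e. $V=V_1\oplus V_2$ with $W$-invariant subspaces such that $W$ acts irreducibly and nontrivially on $V_1$, trivially on $V_2$, and $\dim V_2=1$. Let $\Gamma\subset V$ be a $W$-invariant lattice (of full rank). Let $C$ be a monoconditional symmetric cone, i.e. $C=\{x\in V : \langle\sigma x,\psi\rangle\ge 0 \text{ for all } \sigma\in W\}$ for some linear form $\psi\in V^*$ with $V_1,V_2\not\subset\ker\psi$. Let $F\subset V$ be a fundamental domain for $W$ (the closure of an open set that meets each $W$-orbit in exactly one point), let $H_1,\dots,H_{n-1}$ be its distinct facet hyperplanes, listed in any order, and let $s_j$ be the orthogonal reflection at $H_j$. For $\sigma\in W$ let $l(\sigma)$ be the smallest length of a word in $s_1,\dots,s_{n-1}$ with product $\sigma$, and let $\mathrm{Des}_R(\sigma)=\{j : l(\sigma s_j)<l(\sigma)\}$. Suppose that $C_+=C\cap F$ is unimodular with respect to $\Gamma$, i.e. it is the cone generated by a $\mathbf{Z}$-basis of $\Gamma$; the elements of such a basis are called primitive generators of $C_+$. Then $n=\dim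 V$, and there is a unique enumeration $b_1,\dots,b_n$ of the primitive generators of $C_+$ such that $b_j\notin H_j$ for $1\le j\le n-1$. Moreover, the generating function of $C$ with respect to $\Gamma$ is $$f_C(\varphi)=\sum_{\sigma\in W}\frac{\prod_{j\in \mathrm{Des}_R(\sigma)}e^{-\langle\sigma b_j,\varphi\rangle}}{\prod_{j=1}^n\bigl(1-e^{-\langle\sigma b_j,\varphi\rangle}\bigr)}.$$ That is, the right-hand side is a meromorphic function of $\varphi\in V^*_{\mathbf C}=V^*\otimes_{\mathbf R}\mathbf C$, and on some nonempty open subset of $V^*_{\mathbf C}$ the series $\sum_{x\in C\cap\Gamma}e^{-\langle x,\varphi\rangle}$ converges to it. -/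

import Mathlib

namespace SymCone

noncomputable section

section Groups

variable {V : Type*} [NormedAddCommGroup V] [InnerProductSpace ℝ V]

/-- A linear subspace is invariant under `W`. -/
def IsInvariant (W : Subgroup (V ≃ₗᵢ[ℝ] V)) (U : Submodule ℝ V) : Prop :=
  ∀ σ ∈ W, ∀ x ∈ U, σ x ∈ U

/-- An element of the orthogonal group `O(V)` that is the reflection at the hyperplane orthogonal
to some nonzero vector. -/
def IsHyperplaneReflection (s : V ≃ₗᵢ[ℝ] V) : Prop :=
  ∃ v : V, v ≠ 0 ∧ s = (ℝ ∙ v)ᗮ.reflection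

/-- A subgroup of the orthogonal group that is generated by the hyperplane reflections it
contains. -/
def IsReflectionGroup (W : Subgroup (V ≃ₗᵢ[ℝ] V)) : Prop :=
  Subgroup.closure {s | s ∈ W ∧ IsHyperplaneReflection s} = W

/-- `V = V₁ ⊕ V₂` with `W`-invariant summands, where `W` acts irreducibly and nontrivially on `V₁`
and trivially on the one-dimensional space `V₂`. -/
structure IsAlmostIrreducible (W : Subgroup (V ≃ₗᵢ[ℝ] V)) (V₁ V₂ : Submodule ℝ V) : Prop where
  isCompl : IsCompl V₁ V₂
  invariant : IsInvariant W V₁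
  irreducible : ∀ U : Submodule ℝ V, U ≤ V₁ → IsInvariant W U → U = ⊥ ∨ U = V₁
  nontrivial : ∃ σ ∈ W, ∃ x ∈ V₁, σ x ≠ x
  trivial : ∀ σ ∈ W, ∀ x ∈ V₂, σ x = x
  finrank_eq_one : Module.finrank ℝ V₂ = 1

/-- `C` is a monoconditional symmetric cone. Since `W` is finite, the set on the right-hand side
is automatically a `W`-invariant convex polyhedral cone. -/
def IsMonoconditional (W : Subgroup (V ≃ₗᵢ[ℝ] V)) (V₁ V₂ : Submodule ℝ V) (C : Set V) : Prop :=
  ∃ φ : Module.Dual ℝ V, ¬ V₁ ≤ LinearMap.ker φ ∧ ¬ V₂ ≤ LinearMap.ker φ ∧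
    C = {x | ∀ σ ∈ W, 0 ≤ φ (σ x)}

/-- `F` is the closure of an open set and meets each `W`-orbit in exactly one point. -/
def IsFundamentalDomain (W : Subgroup (V ≃ₗᵢ[ℝ] V)) (F : Set V) : Prop :=
  (∃ U : Set V, IsOpen U ∧ F = closure U) ∧
    ∀ x : V, ∃! y : V, y ∈ F ∧ ∃ σ ∈ W, σ x = y

/-- `H` is a facet hyperplane of the cone `F`: it is a linear hyperplane, `F` lies on one side of
it, and the face `F ∩ H` spans `H`. -/
def IsFacetHyperplane (F : Set V) (H : Submodule ℝ V) : Prop :=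
  (∃ α : Module.Dual ℝ V, α ≠ 0 ∧ LinearMap.ker α = H ∧ ∀ x ∈ F, 0 ≤ α x) ∧
    Submodule.span ℝ (F ∩ (H : Set V)) = H

end Groups

section Descents

variable {G : Type*} [Group G] {r : ℕ}

/-- The smallest length of a word in the generators `s` whose product is `g`. -/
def wordLength (s : Fin r → G) (g : G) : ℕ :=
  sInf {k | ∃ w : List (Fin r), w.length = k ∧ (w.map s).prod = g}

/-- The right descent set. -/
def rightDescents (s : Fin r → G) (g : G) : Finset (Fin r) :=
  Finset.univ.filter fun j => wordLength s (g * s j) < wordLength s g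

end Descents

section Lattice

variable {V : Type*} [NormedAddCommGroup V] [InnerProductSpace ℝ V]

/-- `b` enumerates a `ℤ`-basis of `Γ` that generates the cone `K`. -/
structure IsPrimitiveGenerators {m : ℕ} (Γ : Submodule ℤ V) (K : Set V) (b : Fin m → V) :
    Prop where
  linearIndependent : LinearIndependent ℤ b
  span_eq : Submodule.span ℤ (Set.range b) = Γ
  cone_eq : K = {x | ∃ c : Fin m → ℝ, (∀ j, 0 ≤ c j) ∧ x = ∑ j, c j • b j}

/-- `K` is generated by a basis of the lattice `Γ`. (If `Γ` has full rank, such a cone is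
automatically simplicial and full-dimensional.) -/
def IsUnimodularCone (Γ : Submodule ℤ V) (K : Set V) : Prop :=
  ∃ (m : ℕ) (b : Fin m → V), IsPrimitiveGenerators Γ K b

end Lattice

section GeneratingFunctions

/-- Meromorphic functions on a complex vector space of arbitrary dimension: locally a quotient of
holomorphic functions whose denominator does not vanish identically. The value of `f` at zeros of
the denominator is irrelevant. -/
def IsMeromorphic {E : Type*} [NormedAddCommGroup E] [NormedSpace ℂ E] (f : E → ℂ) : Prop :=
  ∀ z : E, ∃ g h : E → ℂ, AnalyticAt ℂ g z ∧ AnalyticAt ℂ h z ∧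
    (¬ ∀ᶠ w in nhds z, h w = 0) ∧ ∀ᶠ w in nhds z, h w ≠ 0 → f w = g w / h w

variable {V : Type*} [NormedAddCommGroup V] [InnerProductSpace ℝ V]

/-- `f` is the generating function of `S` with respect to `Γ`: a meromorphic function on the
complexified dual of `V` that on some nonempty open set is the sum of the (there convergent) series
`∑_{x ∈ S ∩ Γ} exp (-⟨x, φ⟩)`. The complexified dual `V* ⊗ ℂ` of the finite-dimensional space `V`
is realized as the complex vector space of real-linear maps `V → ℂ`, with `⟨x, φ⟩ = φ x`. -/
def IsGeneratingFunction (Γ : Submodule ℤ V) (S : Set V) (f : (V →L[ℝ] ℂ) → ℂ) : Prop :=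
  IsMeromorphic f ∧ ∃ B : Set (V →L[ℝ] ℂ), IsOpen B ∧ B.Nonempty ∧
    ∀ φ ∈ B, HasSum (fun x : ↥(S ∩ (Γ : Set V)) => Complex.exp (-φ (x : V))) (f φ)

end GeneratingFunctions

end

end SymCone

namespace SymCone

open Filter Topology

/-! ### Hyperplane reflections and isometries with large fixed space -/

section Reflections

variable {V : Type*} [NormedAddCommGroup V] [InnerProductSpace ℝ V]

/-! The cone `C` is the union of the chambers `σ (C ∩ F)`, and the lattice points of one chamber are
the nonnegative integral combinations of the `σ b_j`, so each chamber contributes a product of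
geometric series. Points on walls lie in several chambers. Fix `p` in the interior of `F` and assign
`x` to the unique `σ` such that `x + ε p` lies in `σ F` for all small `ε > 0`. This is the `σ` with
`σ⁻¹ x ∈ F` such that `σ⁻¹ x` lies on no wall `H j` with `j` a right descent of `σ`
(`existsUnique_mem`), because `j` is a right descent exactly if `H j` separates `p` from `σ⁻¹ p`
(`mem_rightDescents_iff`). Hence the coefficients of `b_j`, for descents `j`, must be positive,
which produces the numerators.

Three things make this work. From its orbit property alone, `F` is shown to be the intersection of
the half-spaces containing `p` that are bounded by mirrors of `W` (`mem_iff`). After a translate by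
`W`, a single form `ψ` cuts `C ∩ F` out of `F` (`exists_form`). A vector fixed by `W` with `ψ > 0`
then shows that exactly one facet of the simplicial cone `C ∩ F` comes from `ψ` and the others are
the facets of `F` (`exists_facet_index`). So `F` has one facet fewer than there are generators, and
each wall misses exactly one generator. This gives the enumeration and its uniqueness; `n = dim V`
is encoded in the index type `Fin (r + 1)`.

Convergence needs a form that is positive on all `σ b_j`. The average of `ψ` over `W` serves, since
almost irreducibility keeps `ψ` from vanishing on a nonzero orbit. -/

theorem inv_apply_self (σ : V ≃ₗᵢ[ℝ] V) (x : V) : σ⁻¹ (σ x) = x := σ.symm_apply_apply x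

theorem apply_inv_self (σ : V ≃ₗᵢ[ℝ] V) (x : V) : σ (σ⁻¹ x) = x := σ.apply_symm_apply x

theorem inner_inv_right (σ : V ≃ₗᵢ[ℝ] V) (x y : V) : inner ℝ x (σ⁻¹ y) = inner ℝ (σ x) y := by
  rw [← σ.inner_map_map, apply_inv_self]

theorem reflection_orthogonal_singleton_apply (v x : V) :
    (ℝ ∙ v)ᗮ.reflection x = x - (2 * (inner ℝ v x / ‖v‖ ^ 2)) • v := by
  rw [Submodule.reflection_orthogonal_apply, Submodule.reflection_singleton_apply, neg_sub,
    ← Nat.cast_smul_eq_nsmul ℝ, smul_smul]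
  simp

theorem inner_sub_inner_reflection (v x y : V) :
    inner ℝ x y - inner ℝ ((ℝ ∙ v)ᗮ.reflection x) y
      = 2 / ‖v‖ ^ 2 * (inner ℝ v x * inner ℝ v y) := by
  rw [reflection_orthogonal_singleton_apply, inner_sub_left, real_inner_smul_left]
  ring

namespace IsHyperplaneReflection

variable {t : V ≃ₗᵢ[ℝ] V}

theorem apply_apply (ht : IsHyperplaneReflection t) (x : V) : t (t x) = x := by
  obtain ⟨v, -, rfl⟩ := ht
  exact Submodule.reflection_reflection _ x

theorem inv_eq (ht : IsHyperplaneReflection t) : t⁻¹ = t := by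
  obtain ⟨v, -, rfl⟩ := ht
  exact Submodule.reflection_inv

theorem mul_self (ht : IsHyperplaneReflection t) : t * t = 1 := by
  ext x
  exact ht.apply_apply x

theorem inner_apply_left (ht : IsHyperplaneReflection t) (x y : V) :
    inner ℝ (t x) y = inner ℝ x (t y) := by
  rw [← t.inner_map_map, ht.apply_apply]

theorem ne_one (ht : IsHyperplaneReflection t) : t ≠ 1 := by
  rintro rfl
  obtain ⟨v, hv, h⟩ := ht
  have := Submodule.reflection_orthogonalComplement_singleton_eq_neg (𝕜 := ℝ) v
  rw [← h] at this
  change v = -v at this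
  rw [eq_neg_iff_add_eq_zero, ← two_smul ℝ, smul_eq_zero] at this
  exact hv (this.resolve_left two_ne_zero)

theorem conj (ht : IsHyperplaneReflection t) (σ : V ≃ₗᵢ[ℝ] V) :
    IsHyperplaneReflection (σ * t * σ⁻¹) := by
  obtain ⟨v, hv, rfl⟩ := ht
  refine ⟨σ v, by simpa using hv, ?_⟩
  ext x
  change σ ((ℝ ∙ v)ᗮ.reflection (σ⁻¹ x)) = _
  rw [reflection_orthogonal_singleton_apply, reflection_orthogonal_singleton_apply, map_sub,
    map_smul, apply_inv_self, inner_inv_right, σ.norm_map]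

end IsHyperplaneReflection

/-- An isometry whose fixed space spans `V` together with a single vector is the identity or
a hyperplane reflection. -/
theorem isHyperplaneReflection_of_span_sup_eq_top [FiniteDimensional ℝ V] (w : V ≃ₗᵢ[ℝ] V)
    (hw : w ≠ 1) (p : V) (h : (ℝ ∙ p) ⊔ LinearMap.eqLocus w.toLinearEquiv.toLinearMap 1 = ⊤) :
    IsHyperplaneReflection w := by
  set K := LinearMap.eqLocus w.toLinearEquiv.toLinearMap 1 with hK
  have memK : ∀ x, x ∈ K ↔ w x = x := fun x => Iff.rfl
  -- `v` is the component of `p` orthogonal to the fixed space `K`. The isometry `w` preserves the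
  -- orthogonal complement of `K`, so it scales `v` by `1` or `-1`, and the factor `1` would put `v`
  -- into `K`.
  obtain ⟨v, hvK, hv⟩ : ∃ v ∈ Kᗮ, ∀ x, ∃ k ∈ K, ∃ a : ℝ, x = k + a • v := by
    refine ⟨p - K.orthogonalProjectionOnto p, Submodule.sub_starProjection_mem_orthogonal p,
      fun x => ?_⟩
    have hx : x ∈ (ℝ ∙ p) ⊔ K := h ▸ Submodule.mem_top
    obtain ⟨y, hy, k, hk, rfl⟩ := Submodule.mem_sup.mp hx
    obtain ⟨a, rfl⟩ := Submodule.mem_span_singleton.mp hy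
    exact ⟨k + a • K.orthogonalProjectionOnto p,
      K.add_mem hk (K.smul_mem a (Subtype.property _)), a, by module⟩
  have horth : ∀ k ∈ K, inner ℝ k v = 0 := fun k hk => hvK k hk
  have hv0 : v ≠ 0 := by
    rintro rfl
    apply hw
    ext x
    obtain ⟨k, hk, a, rfl⟩ := hv x
    simpa using (memK k).mp hk
  obtain ⟨k, hk, a, hwv⟩ := hv (w v)
  have hk0 : k = 0 := by
    have h1 : inner ℝ k (w v) = 0 := by
      rw [← (memK k).mp hk, w.inner_map_map]
      exact horth k hk
    rw [hwv, inner_add_right, real_inner_smul_right, horth k hk, mul_zero, add_zero] at h1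
    exact inner_self_eq_zero.mp h1
  rw [hk0, zero_add] at hwv
  have hna : |a| = 1 := by
    have h1 := w.norm_map v
    rw [hwv, norm_smul, Real.norm_eq_abs] at h1
    exact mul_right_cancel₀ (norm_ne_zero_iff.mpr hv0) (by rw [h1, one_mul])
  have ha : a = -1 := by
    rcases (abs_eq zero_le_one).mp hna with rfl | ha
    · refine absurd ?_ hv0
      have : v ∈ K := (memK v).mpr (by rw [hwv, one_smul])
      exact inner_self_eq_zero.mp (horth v this)
    · exact ha
  refine ⟨v, hv0, ?_⟩
  ext x
  obtain ⟨k', hk', c, rfl⟩ := hv x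
  rw [map_add, map_smul, map_add, map_smul,
    Submodule.reflection_orthogonalComplement_singleton_eq_neg,
    Submodule.reflection_mem_subspace_eq_self
      (Submodule.mem_orthogonal_singleton_iff_inner_left.mpr (horth k' hk')),
    hwv, ha, (memK k').mp hk', neg_one_smul]

theorem dense_compl_of_ne_top [FiniteDimensional ℝ V] {K : Submodule ℝ V} (hK : K ≠ ⊤) :
    Dense ((K : Set V)ᶜ) := by
  rw [← interior_eq_empty_iff_dense_compl]
  by_contra h
  exact hK (K.eq_top_of_nonempty_interior' (Set.nonempty_iff_ne_empty.mpr h))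

end Reflections

/-! ### The fundamental domain as an intersection of half-spaces -/

section FundamentalDomain

variable {V : Type*} [NormedAddCommGroup V] [InnerProductSpace ℝ V]
  {W : Subgroup (V ≃ₗᵢ[ℝ] V)} {F : Set V}

namespace IsFundamentalDomain

theorem isClosed (hF : IsFundamentalDomain W F) : IsClosed F := by
  obtain ⟨⟨U, -, rfl⟩, -⟩ := hF
  exact isClosed_closure

theorem exists_apply_mem (hF : IsFundamentalDomain W F) (x : V) : ∃ σ ∈ W, σ x ∈ F := by
  obtain ⟨y, ⟨hy, σ, hσ, rfl⟩, -⟩ := hF.2 x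
  exact ⟨σ, hσ, hy⟩

theorem apply_eq_self (hF : IsFundamentalDomain W F) {x : V} (hx : x ∈ F) {σ : V ≃ₗᵢ[ℝ] V}
    (hσ : σ ∈ W) (hσx : σ x ∈ F) : σ x = x :=
  (hF.2 x).unique ⟨hσx, σ, hσ, rfl⟩ ⟨hx, 1, W.one_mem, rfl⟩

theorem subset_closure_interior (hF : IsFundamentalDomain W F) : F ⊆ closure (interior F) := by
  obtain ⟨⟨U, hU, rfl⟩, -⟩ := hF
  exact closure_mono (interior_maximal subset_closure hU)

theorem exists_mem_interior (hF : IsFundamentalDomain W F) : ∃ p, p ∈ interior F := by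
  obtain ⟨σ, -, h⟩ := hF.exists_apply_mem 0
  exact closure_nonempty_iff.mp ⟨_, hF.subset_closure_interior h⟩

/-- Interior points of a fundamental domain have trivial stabilizer. -/
theorem eq_one_of_apply_eq (hF : IsFundamentalDomain W F) {p : V} (hp : p ∈ interior F)
    {w : V ≃ₗᵢ[ℝ] V} (hw : w ∈ W) (hwp : w p = p) : w = 1 := by
  have h1 : ∀ᶠ q in 𝓝 p, q ∈ F := mem_interior_iff_mem_nhds.mp hp
  have h2 : ∀ᶠ q in 𝓝 p, w q ∈ F := by
    have := w.continuous.tendsto p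
    rw [hwp] at this
    exact this.eventually h1
  have h3 : ∀ᶠ q in 𝓝 p, w q = q := by
    filter_upwards [h1, h2] with q hq hwq using hF.apply_eq_self hq hw hwq
  ext x
  have h4 : Tendsto (fun ε : ℝ => p + ε • x) (𝓝[>] 0) (𝓝 p) := by
    have : Continuous (fun ε : ℝ => p + ε • x) := by fun_prop
    simpa using (this.tendsto 0).mono_left nhdsWithin_le_nhds
  obtain ⟨ε, hε, hε0⟩ := ((h4.eventually h3).and self_mem_nhdsWithin).exists
  rw [map_add, map_smul, hwp, add_right_inj] at hε
  exact smul_right_injective V (ne_of_gt hε0) hε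

theorem inner_apply_lt (hF : IsFundamentalDomain W F) {p : V} (hp : p ∈ interior F)
    {t : V ≃ₗᵢ[ℝ] V} (ht : t ∈ W) (hr : IsHyperplaneReflection t) :
    inner ℝ (t p) p < inner ℝ p p := by
  have h1 : t p ≠ p := fun h => hr.ne_one (hF.eq_one_of_apply_eq hp ht h)
  obtain ⟨v, hv, rfl⟩ := hr
  have h2 := inner_sub_inner_reflection v p p
  have h3 : inner ℝ v p ≠ 0 := fun h => h1 (by
    rw [reflection_orthogonal_singleton_apply, h]; simp)
  have h4 : 0 < 2 / ‖v‖ ^ 2 * (inner ℝ v p * inner ℝ v p) :=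
    mul_pos (by positivity) (mul_self_pos.mpr h3)
  linarith

variable [FiniteDimensional ℝ V] [Finite W]

/-- A generic such point is joined to `p` by a segment of points with trivial stabilizer. Such a
segment cannot leave `F`, because a point common to `F` and a translate `w⁻¹ F` is fixed by `w`.
Closedness of `F` removes the genericity. -/
theorem mem_of_forall_inner_lt (hF : IsFundamentalDomain W F) {p : V} (hp : p ∈ interior F)
    {x : V} (hx : ∀ t ∈ W, IsHyperplaneReflection t → inner ℝ (t x) p < inner ℝ x p) :
    x ∈ F := by
  set D : Set V := {x | ∀ t : W, IsHyperplaneReflection (t : V ≃ₗᵢ[ℝ] V) →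
    inner ℝ ((t : V ≃ₗᵢ[ℝ] V) x) p < inner ℝ x p} with hD
  have hDopen : IsOpen D := by
    rw [hD, Set.ofPred_forall]
    refine isOpen_iInter_of_finite fun t => ?_
    rw [Set.ofPred_forall]
    refine isOpen_iInter_of_finite fun _ => isOpen_lt ?_ ?_
    · exact (t : V ≃ₗᵢ[ℝ] V).continuous.inner continuous_const
    · exact continuous_id.inner continuous_const
  -- If `w` fixes a point other than `p` on the segment from `p` to `y`, then `y` lies in the span
  -- of `p` and the fixed space of `w`. This is a proper subspace unless `w` is `1` or a reflection,
  -- so a generic `y` avoids it. Reflections are controlled by `D` instead.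
  let E : W → Set V := fun w => {y | (w : V ≃ₗᵢ[ℝ] V) ≠ 1 →
    ¬ IsHyperplaneReflection (w : V ≃ₗᵢ[ℝ] V) →
    y ∉ (ℝ ∙ p) ⊔ LinearMap.eqLocus (w : V ≃ₗᵢ[ℝ] V).toLinearEquiv.toLinearMap 1}
  have hE : ∀ w, IsOpen (E w) ∧ Dense (E w) := by
    intro w
    by_cases h : (w : V ≃ₗᵢ[ℝ] V) ≠ 1 ∧ ¬ IsHyperplaneReflection (w : V ≃ₗᵢ[ℝ] V)
    · have : E w = ((((ℝ ∙ p) ⊔ LinearMap.eqLocus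
          (w : V ≃ₗᵢ[ℝ] V).toLinearEquiv.toLinearMap 1 : Submodule ℝ V)) : Set V)ᶜ := by
        ext y
        simp only [E, Set.mem_ofPred_eq, h, not_false_eq_true, forall_const, ne_eq]
        rfl
      rw [this]
      exact ⟨(Submodule.closed_of_finiteDimensional _).isOpen_compl, dense_compl_of_ne_top
        fun htop => h.2 (isHyperplaneReflection_of_span_sup_eq_top _ h.1 p htop)⟩
    · have : E w = Set.univ := Set.eq_univ_of_forall fun y h1 h2 => absurd ⟨h1, h2⟩ h
      rw [this]
      exact ⟨isOpen_univ, dense_univ⟩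
  have hdense : Dense (⋂ w, E w) := dense_iInter_of_isOpen (fun w => (hE w).1) fun w => (hE w).2
  have hsub : D ∩ (⋂ w, E w) ⊆ F := by
    rintro y ⟨hyD, hyE⟩
    -- the segment from `p` to `y` consists of points with trivial stabilizer
    have hfree : ∀ z ∈ segment ℝ p y, ∀ w ∈ W, w z = z → w = 1 := by
      rintro _ ⟨a, c, ha, hc, hac, rfl⟩ w hw hwz
      by_contra hw1
      by_cases hc0 : c = 0
      · subst hc0
        rw [add_zero] at hac
        subst hac
        rw [one_smul, zero_smul, add_zero] at hwz
        exact hw1 (hF.eq_one_of_apply_eq hp hw hwz)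
      by_cases hr : IsHyperplaneReflection w
      · have h1 := hyD ⟨w, hw⟩ hr
        obtain ⟨v, hv, rfl⟩ := hr
        have h2 := inner_sub_inner_reflection v p p
        have h3 : 0 ≤ 2 / ‖v‖ ^ 2 * (inner ℝ v p * inner ℝ v p) :=
          mul_nonneg (by positivity) (mul_self_nonneg _)
        -- The form `z ↦ ⟨z, p⟩ - ⟨w z, p⟩` is nonnegative at `p` and positive at `y`, so it cannot
        -- vanish at a point with `c > 0`.
        have h4 := congrArg (fun u => inner ℝ u p) hwz
        simp only [map_add, map_smul, inner_add_left, real_inner_smul_left] at h4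
        simp only at h1
        have hc' : 0 < c := lt_of_le_of_ne hc (Ne.symm hc0)
        nlinarith
      · refine Set.mem_iInter.mp hyE ⟨w, hw⟩ hw1 hr ?_
        have : y = (-(c⁻¹ * a)) • p + c⁻¹ • (a • p + c • y) := by
          rw [smul_add, smul_smul, smul_smul, inv_mul_cancel₀ hc0]
          module
        rw [this]
        refine Submodule.add_mem_sup (Submodule.smul_mem _ _ (Submodule.mem_span_singleton_self p))
          (Submodule.smul_mem _ _ hwz)
    have hpre : IsPreconnected (segment ℝ p y) := (convex_segment p y).isPreconnected
    have hcl : IsClosed (⋃ w : {w : W // w ≠ 1}, (fun z => ((w : W) : V ≃ₗᵢ[ℝ] V) z) ⁻¹' F) :=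
      isClosed_iUnion_of_finite fun w => hF.isClosed.preimage ((w : W) : V ≃ₗᵢ[ℝ] V).continuous
    by_contra hyF
    have hcover : segment ℝ p y ⊆
        F ∪ ⋃ w : {w : W // w ≠ 1}, (fun z => ((w : W) : V ≃ₗᵢ[ℝ] V) z) ⁻¹' F := by
      intro z _
      obtain ⟨σ, hσ, hz⟩ := hF.exists_apply_mem z
      by_cases h1 : σ = 1
      · subst h1
        exact Or.inl hz
      · refine Or.inr (Set.mem_iUnion.mpr ⟨⟨⟨σ, hσ⟩, fun h => h1 (congrArg Subtype.val h)⟩, hz⟩)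
    obtain ⟨z, hz, hzF, hzU⟩ := isPreconnected_closed_iff.mp hpre _ _ hF.isClosed hcl hcover
      ⟨p, left_mem_segment ℝ p y, interior_subset hp⟩
      ⟨y, right_mem_segment ℝ p y, (hcover (right_mem_segment ℝ p y)).resolve_left hyF⟩
    obtain ⟨⟨⟨w, hw⟩, hw1⟩, hwz⟩ := Set.mem_iUnion.mp hzU
    exact hw1 (Subtype.ext (hfree z hz w hw (hF.apply_eq_self hzF hw hwz)))
  have hxD : x ∈ D := fun t ht => hx t t.2 ht
  have := hdense.open_subset_closure_inter hDopen hxD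
  exact hF.isClosed.closure_subset_iff.mpr hsub this

theorem mem_of_forall_inner_le (hF : IsFundamentalDomain W F) {p : V} (hp : p ∈ interior F)
    {x : V} (hx : ∀ t ∈ W, IsHyperplaneReflection t → inner ℝ (t x) p ≤ inner ℝ x p) :
    x ∈ F := by
  have h1 : Tendsto (fun ε : ℝ => x + ε • p) (𝓝[>] 0) (𝓝 x) := by
    have : Continuous (fun ε : ℝ => x + ε • p) := by fun_prop
    simpa using (this.tendsto 0).mono_left nhdsWithin_le_nhds
  refine hF.isClosed.mem_of_tendsto h1 ?_
  filter_upwards [self_mem_nhdsWithin] with ε hε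
  refine hF.mem_of_forall_inner_lt hp fun t ht hr => ?_
  rw [map_add, map_smul, inner_add_left, inner_add_left, real_inner_smul_left,
    real_inner_smul_left]
  exact add_lt_add_of_le_of_lt (hx t ht hr)
    (mul_lt_mul_of_pos_left (hF.inner_apply_lt hp ht hr) hε)

/-- A point of the finite orbit of `x` that maximizes the inner product with `p` satisfies all
reflection inequalities. It therefore lies in `F` and equals `x`. -/
theorem inner_apply_le_of_mem_interior (hF : IsFundamentalDomain W F) {p x : V}
    (hp : p ∈ interior F) (hx : x ∈ F) {w : V ≃ₗᵢ[ℝ] V} (hw : w ∈ W) :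
    inner ℝ (w x) p ≤ inner ℝ x p := by
  obtain ⟨m, hm⟩ := Finite.exists_max (fun w : W => inner ℝ ((w : V ≃ₗᵢ[ℝ] V) x) p)
  have h1 : (m : V ≃ₗᵢ[ℝ] V) x ∈ F :=
    hF.mem_of_forall_inner_le hp fun t ht _ => hm ⟨t * m, W.mul_mem ht m.2⟩
  have h2 := hm ⟨w, hw⟩
  rwa [hF.apply_eq_self hx m.2 h1] at h2

/-- A point of the fundamental domain is, within its orbit, closest to every point of the
fundamental domain. -/
theorem inner_apply_le (hF : IsFundamentalDomain W F) {x y : V} (hx : x ∈ F) (hy : y ∈ F)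
    {w : V ≃ₗᵢ[ℝ] V} (hw : w ∈ W) : inner ℝ (w x) y ≤ inner ℝ x y := by
  have hcl : IsClosed {y | inner ℝ (w x) y ≤ inner ℝ x y} :=
    isClosed_le (continuous_const.inner continuous_id) (continuous_const.inner continuous_id)
  have : closure (interior F) ⊆ {y | inner ℝ (w x) y ≤ inner ℝ x y} :=
    hcl.closure_subset_iff.mpr fun p hp => hF.inner_apply_le_of_mem_interior hp hx hw
  exact this (hF.subset_closure_interior hy)

/-- A fundamental domain is the intersection of the half-spaces that are cut out by the
reflections in `W` and contain a given interior point. -/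
theorem mem_iff (hF : IsFundamentalDomain W F) {p : V} (hp : p ∈ interior F) {x : V} :
    x ∈ F ↔ ∀ t ∈ W, IsHyperplaneReflection t → inner ℝ (t x) p ≤ inner ℝ x p :=
  ⟨fun hx _ ht _ => hF.inner_apply_le_of_mem_interior hp hx ht, hF.mem_of_forall_inner_le hp⟩

end IsFundamentalDomain

end FundamentalDomain

/-! ### Facets of simplicial cones and of `F` -/

section SimplicialCones

variable {V : Type*} [AddCommGroup V] [Module ℝ V] {ι : Type*} [Fintype ι]

/-- If a simplicial cone is cut out by finitely many linear inequalities, then each of its facets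
is defined by one of these inequalities. -/
theorem exists_eq_smul_coord {κ : Type*} [Finite κ] (b : Module.Basis ι ℝ V)
    (g : κ → Module.Dual ℝ V) (h : ∀ x, (∀ i, 0 ≤ b.coord i x) ↔ ∀ k, 0 ≤ g k x) (i : ι) :
    ∃ k, 0 < g k (b i) ∧ g k = g k (b i) • b.coord i := by
  classical
  have hnn : ∀ k j, 0 ≤ g k (b j) := fun k j => by
    refine (h (b j)).mp (fun l => ?_) k
    rw [b.coord_apply, b.repr_self, Finsupp.single_apply]
    split_ifs <;> norm_num
  -- `y` is a relative interior point of the facet opposite `b i`. Some inequality must be violated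
  -- by `y - ε • b i` for arbitrarily small `ε`; it vanishes at `y`, hence at every other generator.
  set y : V := ∑ j ∈ Finset.univ.erase i, b j with hy
  obtain ⟨k, hky, hki⟩ : ∃ k, g k y ≤ 0 ∧ 0 < g k (b i) := by
    by_contra! hcon
    have hev : ∀ᶠ ε : ℝ in 𝓝[>] 0, ∀ k, 0 ≤ g k (y - ε • b i) := by
      rw [eventually_all]
      intro k
      simp only [map_sub, map_smul, smul_eq_mul]
      rcases le_or_gt (g k y) 0 with hk | hk
      · have h0 : g k (b i) = 0 := le_antisymm (hcon k hk) (hnn k i)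
        have hy0 : 0 ≤ g k y := by
          rw [hy, map_sum]
          exact Finset.sum_nonneg fun j _ => hnn k j
        exact Eventually.of_forall fun ε => by simpa [h0] using hy0
      · have : Tendsto (fun ε : ℝ => g k y - ε * g k (b i)) (𝓝[>] 0) (𝓝 (g k y)) := by
          have hc : Continuous (fun ε : ℝ => g k y - ε * g k (b i)) := by fun_prop
          simpa using (hc.tendsto 0).mono_left nhdsWithin_le_nhds
        exact (this.eventually (lt_mem_nhds hk)).mono fun ε hε => hε.le
    obtain ⟨ε, hε, hε0⟩ := (hev.and self_mem_nhdsWithin).exists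
    have h1 := (h _).mpr hε i
    have h2 : b.coord i y = 0 := by
      rw [hy, map_sum]
      refine Finset.sum_eq_zero fun j hj => ?_
      rw [b.coord_apply, b.repr_self, Finsupp.single_eq_of_ne' (Finset.ne_of_mem_erase hj)]
    rw [map_sub, map_smul, h2, b.coord_apply, b.repr_self, Finsupp.single_eq_same] at h1
    have : (0 : ℝ) < ε := hε0
    simp only [smul_eq_mul] at h1
    linarith
  refine ⟨k, hki, b.ext fun j => ?_⟩
  rw [LinearMap.smul_apply, b.coord_apply, b.repr_self]
  by_cases hj : j = i
  · subst hj
    simp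
  · rw [Finsupp.single_eq_of_ne' hj, smul_zero]
    rw [hy, map_sum] at hky
    exact (Finset.sum_eq_zero_iff_of_nonneg fun j _ => hnn k j).mp
      (le_antisymm hky (Finset.sum_nonneg fun j _ => hnn k j)) j
      (Finset.mem_erase.mpr ⟨hj, Finset.mem_univ j⟩)

end SimplicialCones

section Facets

variable {V : Type*} [NormedAddCommGroup V] [InnerProductSpace ℝ V] {F : Set V}
  {ι : Type*} [Fintype ι]

/-- `F` contains the line through `b k₀`, so a supporting form `α` kills `b k₀`. On `F ∩ ker α`
every coordinate `k` with `α (b k) ≠ 0` vanishes; as this face spans `ker α`, the form is a multiple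
of one coordinate. -/
theorem isFacetHyperplane_iff (b : Module.Basis ι ℝ V) (k₀ : ι)
    (hF : ∀ x, x ∈ F ↔ ∀ i, i ≠ k₀ → 0 ≤ b.coord i x) (L : Submodule ℝ V) :
    IsFacetHyperplane F L ↔ ∃ i, i ≠ k₀ ∧ L = LinearMap.ker (b.coord i) := by
  classical
  have hcoord : ∀ i j, b.coord i (b j) = if j = i then 1 else 0 := fun i j => by
    rw [b.coord_apply, b.repr_self, Finsupp.single_apply]
  have hbF : ∀ j, b j ∈ F := fun j => (hF _).mpr fun i _ => by
    rw [hcoord]; split_ifs <;> norm_num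
  constructor
  · rintro ⟨⟨α, hα0, rfl, hα⟩, hspan⟩
    have h0 : α (b k₀) = 0 := by
      refine le_antisymm ?_ (hα _ (hbF k₀))
      have : -b k₀ ∈ F := (hF _).mpr fun i hi => by
        rw [map_neg, hcoord, if_neg (Ne.symm hi), neg_zero]
      simpa using hα _ this
    obtain ⟨k, hk⟩ : ∃ k, α (b k) ≠ 0 := by
      by_contra! hcon
      exact hα0 (b.ext fun i => by simpa using hcon i)
    have hle : LinearMap.ker α ≤ LinearMap.ker (b.coord k) := by
      rw [← hspan, Submodule.span_le]
      rintro x ⟨hxF, hx⟩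
      have hx' : ∑ i, b.coord i x * α (b i) = 0 := by
        have h1 : α x = 0 := hx
        rw [← b.sum_repr x, map_sum] at h1
        simpa using h1
      have hnn : ∀ i ∈ Finset.univ, 0 ≤ b.coord i x * α (b i) := fun i _ => by
        by_cases hi : i = k₀
        · rw [hi, h0, mul_zero]
        · exact mul_nonneg ((hF x).mp hxF i hi) (hα _ (hbF i))
      have h2 := (Finset.sum_eq_zero_iff_of_nonneg hnn).mp hx' k (Finset.mem_univ k)
      exact (mul_eq_zero.mp h2).resolve_right hk
    refine ⟨k, fun h => hk (h ▸ h0), le_antisymm hle fun x hx => ?_⟩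
    have h1 : x - (α x / α (b k)) • b k ∈ LinearMap.ker α := by
      rw [LinearMap.mem_ker, map_sub, map_smul, smul_eq_mul, div_mul_cancel₀ _ hk, sub_self]
    have h2 := LinearMap.mem_ker.mp (hle h1)
    rw [map_sub, LinearMap.mem_ker.mp hx, map_smul, hcoord, if_pos rfl, smul_eq_mul, mul_one,
      zero_sub, neg_eq_zero, div_eq_zero_iff] at h2
    exact h2.resolve_right hk
  · rintro ⟨i, hi, rfl⟩
    refine ⟨⟨b.coord i, fun h => ?_, rfl, fun x hx => (hF x).mp hx i hi⟩,
      le_antisymm (Submodule.span_le.mpr Set.inter_subset_right) fun x hx => ?_⟩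
    · have := hcoord i i
      rw [h, if_pos rfl] at this
      simp at this
    · rw [← b.sum_repr x]
      refine Submodule.sum_mem _ fun j _ => ?_
      by_cases hj : j = i
      · subst hj
        have : b.repr x j = 0 := hx
        rw [this, zero_smul]
        exact Submodule.zero_mem _
      · exact Submodule.smul_mem _ _ (Submodule.subset_span
          ⟨hbF j, by rw [SetLike.mem_coe, LinearMap.mem_ker, hcoord, if_neg hj]⟩)

end Facets

/-! ### Monoconditional cones and the walls of `C ∩ F` -/

section AlmostIrreducible

variable {V : Type*} [NormedAddCommGroup V] [InnerProductSpace ℝ V]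
  {W : Subgroup (V ≃ₗᵢ[ℝ] V)} {V₁ V₂ : Submodule ℝ V}

theorem apply_sum_orbit [Fintype W] {τ : V ≃ₗᵢ[ℝ] V} (hτ : τ ∈ W) (x : V) :
    τ (∑ σ : W, (σ : V ≃ₗᵢ[ℝ] V) x) = ∑ σ : W, (σ : V ≃ₗᵢ[ℝ] V) x := by
  rw [map_sum]
  exact Equiv.sum_comp (Equiv.mulLeft (⟨τ, hτ⟩ : W)) fun σ : W => (σ : V ≃ₗᵢ[ℝ] V) x

namespace IsAlmostIrreducible

theorem mem_of_forall_apply_eq (h : IsAlmostIrreducible W V₁ V₂) {x : V}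
    (hx : ∀ σ ∈ W, σ x = x) : x ∈ V₂ := by
  have htop : x ∈ V₁ ⊔ V₂ := h.isCompl.sup_eq_top ▸ Submodule.mem_top
  obtain ⟨a, ha, c, hc, rfl⟩ := Submodule.mem_sup.mp htop
  have hfix : ∀ σ ∈ W, σ a = a := fun σ hσ => by
    have := hx σ hσ
    rwa [map_add, h.trivial σ hσ c hc, add_left_inj] at this
  have hinv : IsInvariant W (ℝ ∙ a) := fun σ hσ y hy => by
    obtain ⟨d, rfl⟩ := Submodule.mem_span_singleton.mp hy
    rwa [map_smul, hfix σ hσ]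
  rcases h.irreducible (ℝ ∙ a) (by simpa using ha) hinv with h0 | h0
  · rw [Submodule.span_singleton_eq_bot] at h0
    rwa [h0, zero_add]
  · obtain ⟨σ, hσ, y, hy, hne⟩ := h.nontrivial
    rw [← h0] at hy
    obtain ⟨d, rfl⟩ := Submodule.mem_span_singleton.mp hy
    exact absurd (by rw [map_smul, hfix σ hσ]) hne

theorem mem_of_sum_orbit_eq_zero [Fintype W] (h : IsAlmostIrreducible W V₁ V₂) {x : V}
    (hx : ∑ σ : W, (σ : V ≃ₗᵢ[ℝ] V) x = 0) : x ∈ V₁ := by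
  have htop : x ∈ V₁ ⊔ V₂ := h.isCompl.sup_eq_top ▸ Submodule.mem_top
  obtain ⟨a, ha, c, hc, rfl⟩ := Submodule.mem_sup.mp htop
  simp only [map_add, Finset.sum_add_distrib] at hx
  have h1 : ∑ σ : W, (σ : V ≃ₗᵢ[ℝ] V) a ∈ V₁ :=
    Submodule.sum_mem _ fun σ _ => h.invariant σ σ.2 a ha
  have h2 : ∑ σ : W, (σ : V ≃ₗᵢ[ℝ] V) c = (Fintype.card W : ℝ) • c := by
    rw [Finset.sum_congr rfl fun (σ : W) _ => h.trivial σ σ.2 c hc, Finset.sum_const,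
      Finset.card_univ, Nat.cast_smul_eq_nsmul]
  have h3 : (Fintype.card W : ℝ) • c ∈ V₁ := by
    rw [← h2, eq_neg_of_add_eq_zero_right hx]
    exact V₁.neg_mem h1
  have hcard : (Fintype.card W : ℝ) ≠ 0 := Nat.cast_ne_zero.mpr Fintype.card_ne_zero
  have h4 : c ∈ V₁ := (Submodule.smul_mem_iff _ hcard).mp h3
  exact V₁.add_mem ha h4

/-- A linear form that vanishes identically neither on `V₁` nor on `V₂` does not vanish
identically on any nonzero orbit. -/
theorem eq_zero_of_forall_apply_eq_zero [Fintype W] (h : IsAlmostIrreducible W V₁ V₂)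
    {ψ : Module.Dual ℝ V} (hψ₁ : ¬ V₁ ≤ LinearMap.ker ψ) {v : V} (hv : v ∈ V₂) (hψv : ψ v ≠ 0)
    {x : V} (hx : ∀ σ ∈ W, ψ (σ x) = 0) : x = 0 := by
  -- `U` is the largest invariant subspace of `ker ψ`. The orbit sum of a vector of `U` lies in the
  -- line `V₂` and is killed by `ψ`, so it is zero. This places `U` inside `V₁`, where
  -- irreducibility applies.
  let U : Submodule ℝ V := ⨅ σ : W, (LinearMap.ker ψ).comap
    (σ : V ≃ₗᵢ[ℝ] V).toLinearEquiv.toLinearMap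
  have memU : ∀ y, y ∈ U ↔ ∀ σ ∈ W, ψ (σ y) = 0 := fun y => by
    simp only [U, Submodule.mem_iInf, Submodule.mem_comap, LinearMap.mem_ker, Subtype.forall]
    rfl
  have hU₁ : U ≤ V₁ := fun y hy => by
    apply h.mem_of_sum_orbit_eq_zero
    set z := ∑ σ : W, (σ : V ≃ₗᵢ[ℝ] V) y with hz
    have hz₂ : z ∈ V₂ := h.mem_of_forall_apply_eq fun σ hσ => apply_sum_orbit hσ y
    obtain ⟨c, hc⟩ := (finrank_eq_one_iff_of_nonzero' (⟨v, hv⟩ : V₂)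
      (fun h0 => hψv (by rw [show v = 0 from congrArg Subtype.val h0, map_zero]))).mp
        h.finrank_eq_one ⟨z, hz₂⟩
    have hc' : c • v = z := congrArg Subtype.val hc
    have hψz : ψ z = 0 := by
      rw [hz, map_sum]
      exact Finset.sum_eq_zero fun σ _ => (memU y).mp hy σ σ.2
    rw [← hc', map_smul, smul_eq_mul] at hψz
    rw [← hc', (mul_eq_zero.mp hψz).resolve_right hψv, zero_smul]
  have hinv : IsInvariant W U := fun τ hτ y hy => (memU _).mpr fun σ hσ =>
    (memU y).mp hy (σ * τ) (W.mul_mem hσ hτ)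
  rcases h.irreducible U hU₁ hinv with h0 | h0
  · exact (Submodule.mem_bot ℝ).mp (h0 ▸ (memU x).mpr hx)
  · exact absurd (fun y hy => (memU y).mp (h0 ▸ hy) 1 W.one_mem) hψ₁

end IsAlmostIrreducible

/-- A linear form defining a monoconditional cone can be chosen in such a way that, within the
fundamental domain, the cone is defined by this form alone. -/
theorem IsMonoconditional.exists_form [FiniteDimensional ℝ V] [Finite W] {C F : Set V}
    (hC : IsMonoconditional W V₁ V₂ C) (hirr : IsAlmostIrreducible W V₁ V₂)
    (hF : IsFundamentalDomain W F) :
    ∃ ψ : Module.Dual ℝ V, ¬ V₁ ≤ LinearMap.ker ψ ∧ (∃ v ∈ V₂, 0 < ψ v) ∧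
      C = {x | ∀ σ ∈ W, 0 ≤ ψ (σ x)} ∧ C ∩ F = {x | x ∈ F ∧ 0 ≤ ψ x} := by
  obtain ⟨φ, h₁, h₂, rfl⟩ := hC
  obtain ⟨f, hf⟩ : ∃ f : V, ∀ x, φ x = inner ℝ f x :=
    ⟨(InnerProductSpace.toDual ℝ V).symm (LinearMap.toContinuousLinearMap φ), fun x => by
      rw [InnerProductSpace.toDual_symm_apply]; rfl⟩
  -- Translating the form by `W` does not change `C`. Once `-f` is moved into `F`, `inner_apply_le`
  -- makes `ψ x` the smallest value of `ψ` on the orbit of any `x ∈ F`.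
  obtain ⟨w, hw, hwF⟩ := hF.exists_apply_mem (-f)
  have hψ : ∀ x, φ (w⁻¹ x) = -inner ℝ x (w (-f)) := fun x => by
    rw [hf, inner_inv_right, map_neg, inner_neg_right, neg_neg, real_inner_comm]
  have hC : {x | ∀ σ ∈ W, 0 ≤ φ (σ x)} = {x | ∀ σ ∈ W, 0 ≤ φ (w⁻¹ (σ x))} := by
    ext x
    refine ⟨fun h σ hσ => h (w⁻¹ * σ) (W.mul_mem (W.inv_mem hw) hσ), fun h σ hσ => ?_⟩
    have := h (w * σ) (W.mul_mem hw hσ)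
    rwa [LinearIsometryEquiv.coe_mul, Function.comp_apply, inv_apply_self] at this
  refine ⟨φ ∘ₗ (w⁻¹).toLinearEquiv.toLinearMap, fun h => h₁ fun x hx => ?_, ?_, hC, ?_⟩
  · have h3 : φ (w⁻¹ (w x)) = 0 := h (hirr.invariant w hw x hx)
    rwa [inv_apply_self] at h3
  · obtain ⟨v, hv, hv0⟩ := Set.not_subset.mp h₂
    have hv0 : φ v ≠ 0 := hv0
    have hfix : ∀ u ∈ V₂, w⁻¹ u = u := fun u hu => hirr.trivial _ (W.inv_mem hw) u hu
    rcases lt_or_gt_of_ne hv0 with h | h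
    · refine ⟨-v, V₂.neg_mem hv, ?_⟩
      change 0 < φ (w⁻¹ (-v))
      rw [hfix _ (V₂.neg_mem hv), map_neg]
      linarith
    · refine ⟨v, hv, ?_⟩
      change 0 < φ (w⁻¹ v)
      rwa [hfix v hv]
  · rw [hC]
    ext x
    constructor
    · exact fun h => ⟨h.2, h.1 1 W.one_mem⟩
    · refine fun h => ⟨fun σ hσ => ?_, h.1⟩
      have h2 : 0 ≤ φ (w⁻¹ x) := h.2
      have := hF.inner_apply_le h.1 hwF hσ
      rw [hψ] at h2 ⊢
      linarith

/-- The facets of a simplicial cone that is cut out of the fundamental domain by one linear form: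
one facet is defined by that form, the others by reflections in `W`. -/
theorem IsFundamentalDomain.exists_facet_index [FiniteDimensional ℝ V] [Finite W] {C F : Set V}
    (hF : IsFundamentalDomain W F) {p : V} (hp : p ∈ interior F) {ψ : Module.Dual ℝ V} {v : V}
    (hv : ∀ σ ∈ W, σ v = v) (hψv : 0 < ψ v) (hCF : C ∩ F = {x | x ∈ F ∧ 0 ≤ ψ x})
    {ι : Type*} [Fintype ι] (b : Module.Basis ι ℝ V) (hb : C ∩ F = {x | ∀ i, 0 ≤ b.coord i x}) :
    ∃ k₀, (∃ c : ℝ, 0 < c ∧ ψ = c • b.coord k₀) ∧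
      (∀ x, x ∈ F ↔ ∀ i, i ≠ k₀ → 0 ≤ b.coord i x) ∧
      ∀ i, i ≠ k₀ → ∃ t ∈ W, IsHyperplaneReflection t ∧ (∀ x, t x = x ↔ b.coord i x = 0) ∧
        ∃ c : ℝ, 0 < c ∧ ∀ x, inner ℝ p x - inner ℝ (t p) x = c * b.coord i x := by
  -- `none` stands for `ψ`, and `some t` for the half-space of the reflection `t` that contains `p`.
  -- All these forms except `ψ` vanish at the fixed vector `v`.
  let g : Option {t : W // IsHyperplaneReflection (t : V ≃ₗᵢ[ℝ] V)} → Module.Dual ℝ V :=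
    fun o => o.elim ψ fun t => innerₗ V (p - ((t : W) : V ≃ₗᵢ[ℝ] V) p)
  have hg : ∀ t x,
      g (some t) x = inner ℝ x p - inner ℝ (((t : W) : V ≃ₗᵢ[ℝ] V) x) p := fun t x => by
    change inner ℝ (p - ((t : W) : V ≃ₗᵢ[ℝ] V) p) x = _
    rw [inner_sub_left, t.2.inner_apply_left, real_inner_comm, real_inner_comm p,
      real_inner_comm (((t : W) : V ≃ₗᵢ[ℝ] V) x)]
  have hFg : ∀ x, x ∈ F ↔ ∀ t, 0 ≤ g (some t) x := fun x => by
    rw [hF.mem_iff hp]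
    simp only [hg, sub_nonneg]
    exact ⟨fun h t => h _ t.1.2 t.2, fun h t ht hr => h ⟨⟨t, ht⟩, hr⟩⟩
  have hcone : ∀ x, (∀ i, 0 ≤ b.coord i x) ↔ ∀ k, 0 ≤ g k x := fun x => by
    have h1 : (∀ i, 0 ≤ b.coord i x) ↔ x ∈ C ∩ F := by rw [hb]; rfl
    rw [h1, hCF, Option.forall]
    change x ∈ F ∧ 0 ≤ ψ x ↔ _
    rw [hFg]
    exact and_comm
  have hgv : ∀ t, g (some t) v = 0 := fun t => by
    rw [hg, hv _ t.1.2, sub_self]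
  choose k hkpos hk using exists_eq_smul_coord b g hcone
  have hcv : ∀ i, k i ≠ none → b.coord i v = 0 := fun i hi => by
    obtain ⟨t, ht⟩ := Option.ne_none_iff_exists'.mp hi
    have h1 := congrArg (fun l => l v) (hk i)
    simp only [LinearMap.smul_apply, smul_eq_mul] at h1
    rw [ht, hgv] at h1
    exact (mul_eq_zero.mp h1.symm).resolve_left (ht ▸ (hkpos i).ne')
  have huniq : ∀ i j, k i = none → k j = none → i = j := fun i j hi hj => by
    by_contra hne
    have h1 := congrArg (fun l => l (b j)) (hk i)
    simp only [LinearMap.smul_apply, b.coord_apply, b.repr_self, hi] at h1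
    rw [Finsupp.single_eq_of_ne hne, smul_zero] at h1
    have h2 := hkpos j
    rw [hj, h1] at h2
    exact lt_irrefl _ h2
  obtain ⟨k₀, hk₀⟩ : ∃ k₀, k k₀ = none := by
    by_contra! hcon
    have : v = 0 := b.ext_elem fun i => by simpa using hcv i (hcon i)
    rw [this, map_zero] at hψv
    exact lt_irrefl _ hψv
  have hsome : ∀ i, i ≠ k₀ → k i ≠ none := fun i hi h => hi (huniq i k₀ h hk₀)
  refine ⟨k₀, ⟨ψ (b k₀), ?_, ?_⟩, fun x => ⟨fun hx i hi => ?_, fun hx => ?_⟩, fun i hi => ?_⟩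
  · have := hkpos k₀
    rwa [hk₀] at this
  · have := hk k₀
    rwa [hk₀] at this
  · obtain ⟨t, ht⟩ := Option.ne_none_iff_exists'.mp (hsome i hi)
    have h1 := congrArg (fun l => l x) (hk i)
    simp only [LinearMap.smul_apply, smul_eq_mul] at h1
    have h2 : 0 ≤ g (k i) x := by rw [ht]; exact (hFg x).mp hx t
    rw [h1] at h2
    exact nonneg_of_mul_nonneg_right h2 (hkpos i)
  -- Adding a multiple of `v` changes only the coordinate `k₀`, and no reflection form. So `x` can
  -- be shifted into `C ∩ F` without affecting membership in `F`.
  · obtain ⟨a, ha⟩ : ∃ a : ℝ, 0 ≤ b.coord k₀ (x + a • v) := by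
      have h1 : 0 < b.coord k₀ v := by
        have h2 := congrArg (fun l => l v) (hk k₀)
        simp only [LinearMap.smul_apply, smul_eq_mul] at h2
        have h3 : 0 < g (k k₀) v := by rw [hk₀]; exact hψv
        rw [h2] at h3
        exact pos_of_mul_pos_right h3 (hkpos k₀).le
      refine ⟨-b.coord k₀ x / b.coord k₀ v, ?_⟩
      rw [map_add, map_smul, smul_eq_mul, div_mul_cancel₀ _ h1.ne', add_neg_cancel]
    have h3 : ∀ i, 0 ≤ b.coord i (x + a • v) := fun i => by
      by_cases hi : i = k₀
      · rwa [hi]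
      · rw [map_add, map_smul, hcv i (hsome i hi), smul_zero, add_zero]
        exact hx i hi
    have h4 := (hcone _).mp h3
    refine (hFg x).mpr fun t => ?_
    have := h4 (some t)
    rwa [map_add, map_smul, hgv, smul_zero, add_zero] at this
  · obtain ⟨t, ht⟩ := Option.ne_none_iff_exists'.mp (hsome i hi)
    refine ⟨t.1, t.1.2, t.2, fun x => ?_, g (k i) (b i), hkpos i, fun x => ?_⟩
    swap
    · rw [← inner_sub_left]
      change innerₗ V (p - ((t : W) : V ≃ₗᵢ[ℝ] V) p) x = _
      rw [← smul_eq_mul, ← LinearMap.smul_apply, ← hk i, ht]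
      rfl
    have h1 := congrArg (fun l => l x) (hk i)
    simp only [LinearMap.smul_apply, smul_eq_mul] at h1
    have h2 : g (k i) x = 0 ↔ b.coord i x = 0 := by
      rw [h1, mul_eq_zero, or_iff_right (hkpos i).ne']
    rw [← h2, ht, hg]
    refine ⟨fun h => by rw [h, sub_self], fun h => ?_⟩
    have h3 := hF.inner_apply_lt hp t.1.2 t.2
    obtain ⟨u, hu, htu⟩ := t.2
    rw [htu, inner_sub_inner_reflection] at h
    rw [htu] at h3 ⊢
    have h4 := inner_sub_inner_reflection u p p
    have hup : inner ℝ u p ≠ 0 := fun h0 => by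
      rw [h0, mul_zero, mul_zero] at h4
      linarith
    have h5 : (2 / ‖u‖ ^ 2 : ℝ) ≠ 0 := by positivity
    have h6 := (mul_eq_zero.mp ((mul_eq_zero.mp h).resolve_left h5)).resolve_right hup
    exact Submodule.reflection_mem_subspace_eq_self
      (Submodule.mem_orthogonal_singleton_iff_inner_right.mpr h6)

end AlmostIrreducible

/-! ### Word length as the number of separating mirrors -/

section Length

variable {V : Type*} [NormedAddCommGroup V] [InnerProductSpace ℝ V]

theorem IsHyperplaneReflection.inner_sub {t : V ≃ₗᵢ[ℝ] V} (ht : IsHyperplaneReflection t) :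
    ∃ v : V, ∃ c : ℝ, 0 < c ∧ ∀ x y, inner ℝ x y - inner ℝ (t x) y
      = c * (inner ℝ v x * inner ℝ v y) ∧ (inner ℝ v x = 0 ↔ t x = x) := by
  obtain ⟨v, hv, rfl⟩ := ht
  refine ⟨v, 2 / ‖v‖ ^ 2, by positivity, fun x y => ⟨inner_sub_inner_reflection v x y, ?_⟩⟩
  rw [Submodule.reflection_eq_self_iff, Submodule.mem_orthogonal_singleton_iff_inner_right]

theorem IsHyperplaneReflection.eq_reflection {t : V ≃ₗᵢ[ℝ] V} (ht : IsHyperplaneReflection t)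
    {K : Submodule ℝ V} [K.HasOrthogonalProjection] (h : ∀ x, t x = x ↔ x ∈ K) :
    t = K.reflection := by
  obtain ⟨v, hv, rfl⟩ := ht
  have : (ℝ ∙ v)ᗮ = K := by
    ext x
    rw [← h, Submodule.reflection_eq_self_iff]
  subst this
  rfl

theorem IsHyperplaneReflection.eq_of_forall_apply_eq {s t : V ≃ₗᵢ[ℝ] V}
    (hs : IsHyperplaneReflection s) (ht : IsHyperplaneReflection t)
    (h : ∀ x, s x = x → t x = x) : t = s := by
  obtain ⟨u, hu, rfl⟩ := hs
  obtain ⟨v, hv, rfl⟩ := ht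
  simp only [Submodule.reflection_eq_self_iff] at h
  have hle : v ∈ (ℝ ∙ u) := by
    rw [← Submodule.orthogonal_orthogonal (ℝ ∙ u), Submodule.mem_orthogonal]
    exact fun x hx => Submodule.mem_orthogonal_singleton_iff_inner_left.mp (h x hx)
  obtain ⟨c, rfl⟩ := Submodule.mem_span_singleton.mp hle
  have hc : IsUnit c := IsUnit.mk0 c fun h0 => hv (by rw [h0, zero_smul])
  simp only [Submodule.span_singleton_smul_eq hc]

theorem mul_neg_iff_of_mul_pos {a c : ℝ} (h : 0 < a * c) (y : ℝ) : c * y < 0 ↔ a * y < 0 := by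
  rcases mul_pos_iff.mp h with ⟨ha, hc⟩ | ⟨ha, hc⟩
  · rw [mul_neg_iff, mul_neg_iff]
    simp [ha, hc, ha.not_gt, hc.not_gt]
  · rw [mul_neg_iff, mul_neg_iff]
    simp [ha, hc, ha.not_gt, hc.not_gt]

/-- The reflections at the walls of the fundamental domain `F`, which has the interior point
`p`. -/
structure IsSimpleSystem (W : Subgroup (V ≃ₗᵢ[ℝ] V)) (F : Set V) (p : V) {r : ℕ}
    (s : Fin r → V ≃ₗᵢ[ℝ] V) : Prop where
  isFundamentalDomain : IsFundamentalDomain W F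
  mem_interior : p ∈ interior F
  mem : ∀ j, s j ∈ W
  isHyperplaneReflection : ∀ j, IsHyperplaneReflection (s j)
  mem_of_forall : ∀ x, (∀ j, inner ℝ (s j p) x ≤ inner ℝ p x) → x ∈ F
  mem_span : ∀ j x, s j x = x → x ∈ Submodule.span ℝ {y | y ∈ F ∧ s j y = y}

open Classical in
/-- The number of reflecting hyperplanes of `W` between `p` and `y`. -/
noncomputable def separationNumber (W : Subgroup (V ≃ₗᵢ[ℝ] V)) [Fintype W] (p y : V) : ℕ :=
  (Finset.univ.filter fun t : W => IsHyperplaneReflection (t : V ≃ₗᵢ[ℝ] V) ∧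
    inner ℝ p y < inner ℝ ((t : V ≃ₗᵢ[ℝ] V) p) y).card

namespace IsSimpleSystem

variable {W : Subgroup (V ≃ₗᵢ[ℝ] V)} {F : Set V} {p : V} {r : ℕ} {s : Fin r → V ≃ₗᵢ[ℝ] V}

/-- Equality would mean that `s j` fixes `p` or `σ⁻¹ p`, both of which have trivial stabilizer. -/
theorem inner_ne (h : IsSimpleSystem W F p s) {σ : V ≃ₗᵢ[ℝ] V} (hσ : σ ∈ W) (j : Fin r) :
    inner ℝ (s j p) (σ⁻¹ p) ≠ inner ℝ p (σ⁻¹ p) := by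
  have hF := h.isFundamentalDomain
  have hsr := h.isHyperplaneReflection j
  intro h0
  obtain ⟨v, c, hc, hv⟩ := hsr.inner_sub
  have h1 := (hv p (σ⁻¹ p)).1
  rw [h0, sub_self, eq_comm, mul_eq_zero, or_iff_right hc.ne', mul_eq_zero] at h1
  have hne := hsr.ne_one
  rcases h1 with h1 | h1
  · exact hne (hF.eq_one_of_apply_eq h.mem_interior (h.mem j) ((hv p p).2.mp h1))
  · have h2 := (hv (σ⁻¹ p) p).2.mp h1
    have h3 := hF.eq_one_of_apply_eq (w := σ * s j * σ⁻¹) h.mem_interior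
      (W.mul_mem (W.mul_mem hσ (h.mem j)) (W.inv_mem hσ)) (by
        change σ (s j (σ⁻¹ p)) = p
        rw [h2, apply_inv_self])
    apply hne
    have : s j = σ⁻¹ * (σ * s j * σ⁻¹) * σ := by group
    rw [this, h3]
    group

theorem mul_inv_apply (h : IsSimpleSystem W F p s) (σ : V ≃ₗᵢ[ℝ] V) (j : Fin r) (x : V) :
    (σ * s j)⁻¹ x = s j (σ⁻¹ x) := by
  rw [mul_inv_rev, (h.isHyperplaneReflection j).inv_eq]
  rfl

theorem prod_mem (h : IsSimpleSystem W F p s) (l : List (Fin r)) : (l.map s).prod ∈ W :=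
  W.list_prod_mem fun x hx => by
    obtain ⟨j, -, rfl⟩ := List.mem_map.mp hx
    exact h.mem j

variable [Fintype W]

theorem separationNumber_self (h : IsSimpleSystem W F p s) : separationNumber W p p = 0 := by
  classical
  refine Finset.card_eq_zero.mpr (Finset.filter_eq_empty_iff.mpr fun t _ ht => ?_)
  exact lt_asymm ht.2 (h.isFundamentalDomain.inner_apply_lt h.mem_interior t.2 ht.1)

variable [FiniteDimensional ℝ V]

/-- The only reflecting hyperplane between an interior point and its mirror image with respect to
a wall is that wall. -/
theorem mul_inner_pos (h : IsSimpleSystem W F p s) {t : V ≃ₗᵢ[ℝ] V} (ht : t ∈ W)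
    (hr : IsHyperplaneReflection t) {j : Fin r} (hne : t ≠ s j) {v : V}
    {c : ℝ} (hc : 0 < c) (hv : ∀ x y, inner ℝ x y - inner ℝ (t x) y
      = c * (inner ℝ v x * inner ℝ v y) ∧ (inner ℝ v x = 0 ↔ t x = x)) :
    0 < inner ℝ v p * inner ℝ v (s j p) := by
  have hF := h.isFundamentalDomain
  have hsr := h.isHyperplaneReflection j
  by_contra hcon
  refine hne (hsr.eq_of_forall_apply_eq hr fun x hx => ?_)
  have hp0 : inner ℝ v p ≠ 0 := fun h0 =>
    hr.ne_one (hF.eq_one_of_apply_eq h.mem_interior ht ((hv p p).2.mp h0))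
  have hsp0 : inner ℝ v (s j p) ≠ 0 := fun h0 => by
    have h1 := (hv (s j p) p).2.mp h0
    have h2 : (s j)⁻¹ * t * s j = 1 := hF.eq_one_of_apply_eq h.mem_interior
      (W.mul_mem (W.mul_mem (W.inv_mem (h.mem j)) ht) (h.mem j)) (by
        change (s j)⁻¹ (t (s j p)) = p
        rw [h1, inv_apply_self])
    have h3 : t = 1 := by
      have : t = s j * ((s j)⁻¹ * t * s j) * (s j)⁻¹ := by group
      rw [this, h2]
      group
    exact hr.ne_one h3
  have hneg : inner ℝ v p * inner ℝ v (s j p) < 0 :=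
    lt_of_le_of_ne (not_lt.mp hcon) (mul_ne_zero hp0 hsp0)
  -- Such a `y` lies in both `F` and `s j F`, so neither `p` nor `s j p` is strictly separated from
  -- it by the mirror of `t`. As this mirror separates `p` from `s j p`, it contains `y`. These `y`
  -- span the mirror of `s j`, so the two mirrors agree.
  have hfix : ∀ y ∈ F, s j y = y → t y = y := fun y hy hsy => by
    rw [← (hv y y).2]
    have h1 : 0 ≤ inner ℝ v y * inner ℝ v p := by
      have := hF.inner_apply_le_of_mem_interior h.mem_interior hy ht
      have h2 := (hv y p).1
      exact nonneg_of_mul_nonneg_right (by linarith) hc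
    have h2 : 0 ≤ inner ℝ v y * inner ℝ v (s j p) := by
      have h3 := hF.inner_apply_le_of_mem_interior h.mem_interior hy
        (W.mul_mem (W.mul_mem (h.mem j) ht) (h.mem j))
      have h4 : inner ℝ ((s j * t * s j) y) p = inner ℝ (t y) (s j p) := by
        change inner ℝ (s j (t (s j y))) p = _
        rw [hsy, hsr.inner_apply_left]
      rw [h4] at h3
      have h5 := (hv y (s j p)).1
      have h6 : inner ℝ y (s j p) = inner ℝ y p := by
        rw [← hsr.inner_apply_left, hsy]
      exact nonneg_of_mul_nonneg_right (by linarith) hc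
    by_contra hy0
    have h7 : 0 < inner ℝ v y * inner ℝ v y := mul_self_pos.mpr hy0
    nlinarith [mul_nonneg h1 h2]
  have hmem := h.mem_span j x hx
  have hle : Submodule.span ℝ {y | y ∈ F ∧ s j y = y}
      ≤ LinearMap.eqLocus t.toLinearEquiv.toLinearMap 1 :=
    Submodule.span_le.mpr fun y hy => hfix y hy.1 hy.2
  exact hle hmem

/-- Conjugation by `s j` matches the mirrors other than that of `s j` separating `p` from `y` with
those separating `p` from `s j y`, because `p` and `s j p` lie on the same side of each
(`mul_inner_pos`). The mirror of `s j` itself is new. -/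
theorem separationNumber_apply (h : IsSimpleSystem W F p s) {j : Fin r} {y : V}
    (hy : inner ℝ (s j p) y < inner ℝ p y) :
    separationNumber W p (s j y) = separationNumber W p y + 1 := by
  classical
  have hsr := h.isHyperplaneReflection j
  let a : W := ⟨s j, h.mem j⟩
  have haa : a * a = 1 := Subtype.ext hsr.mul_self
  have hainv : a⁻¹ = a := inv_eq_of_mul_eq_one_right haa
  let P : V → W → Prop := fun y t => IsHyperplaneReflection (t : V ≃ₗᵢ[ℝ] V) ∧
    inner ℝ p y < inner ℝ ((t : V ≃ₗᵢ[ℝ] V) p) y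
  have hconj : ∀ t : W, t ≠ a → (P (s j y) (a * t * a⁻¹) ↔ P y t) := fun t hta => by
    have hcr : IsHyperplaneReflection ((a * t * a⁻¹ : W) : V ≃ₗᵢ[ℝ] V) ↔
        IsHyperplaneReflection (t : V ≃ₗᵢ[ℝ] V) := by
      refine ⟨fun hr => ?_, fun hr => hr.conj (s j)⟩
      have := hr.conj (s j)⁻¹
      convert this using 1
      change (t : V ≃ₗᵢ[ℝ] V) = (s j)⁻¹ * (s j * t * (s j)⁻¹) * (s j)⁻¹⁻¹
      group
    simp only [P, hcr]
    refine and_congr_right fun hr => ?_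
    obtain ⟨v, c, hc, hv⟩ := hr.inner_sub
    have hpos := h.mul_inner_pos t.2 hr (fun h0 => hta (Subtype.ext h0)) hc hv
    have h1 : inner ℝ (((a * t * a⁻¹ : W) : V ≃ₗᵢ[ℝ] V) p) (s j y)
        = inner ℝ ((t : V ≃ₗᵢ[ℝ] V) (s j p)) y := by
      rw [hainv]
      change inner ℝ (s j ((t : V ≃ₗᵢ[ℝ] V) (s j p))) (s j y) = _
      rw [LinearIsometryEquiv.inner_map_map]
    have hneg : ∀ z : ℝ, c * z < 0 ↔ z < 0 := fun z => smul_neg_iff_of_pos_left hc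
    rw [h1, ← hsr.inner_apply_left, ← sub_neg, ← sub_neg (a := inner ℝ p y), (hv _ _).1,
      (hv _ _).1, hneg, hneg]
    exact mul_neg_iff_of_mul_pos hpos _
  have ha1 : ¬ P y a := fun h0 => lt_asymm h0.2 hy
  have ha2 : P (s j y) a := ⟨hsr, by
    change inner ℝ p (s j y) < inner ℝ (s j p) (s j y)
    rw [LinearIsometryEquiv.inner_map_map, ← hsr.inner_apply_left]
    exact hy⟩
  have himage : Finset.univ.filter (P (s j y))
      = insert a ((Finset.univ.filter (P y)).image fun t => a * t * a⁻¹) := by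
    ext t
    simp only [Finset.mem_filter, Finset.mem_univ, true_and, Finset.mem_insert, Finset.mem_image]
    constructor
    · intro ht
      by_cases hta : t = a
      · exact Or.inl hta
      · refine Or.inr ⟨a⁻¹ * t * a, ?_, by group⟩
        rw [← hconj]
        · convert ht using 1
          group
        · intro h0
          apply hta
          have : t = a * (a⁻¹ * t * a) * a⁻¹ := by group
          rw [this, h0]
          group
    · rintro (rfl | ⟨u, hu, rfl⟩)
      · exact ha2
      · exact (hconj u fun h0 => ha1 (h0 ▸ hu)).mpr hu
  have hinj : Function.Injective fun t : W => a * t * a⁻¹ := fun t u htu => by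
    simpa using htu
  change (Finset.univ.filter (P (s j y))).card = (Finset.univ.filter (P y)).card + 1
  rw [himage, Finset.card_insert_of_notMem, Finset.card_image_of_injective _ hinj]
  simp only [Finset.mem_filter, Finset.mem_univ, true_and, Finset.mem_image, not_exists, not_and]
  intro t ht h0
  refine ha1 ?_
  have : t = a := by
    have h2 : t = a⁻¹ * (a * t * a⁻¹) * a := by group
    rw [h2, h0]
    group
  exact this ▸ ht

theorem separationNumber_apply_of_gt (h : IsSimpleSystem W F p s) {j : Fin r} {y : V}
    (hy : inner ℝ p y < inner ℝ (s j p) y) :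
    separationNumber W p y = separationNumber W p (s j y) + 1 := by
  have hsr := h.isHyperplaneReflection j
  have := h.separationNumber_apply (j := j) (y := s j y) (by
    rw [LinearIsometryEquiv.inner_map_map, ← hsr.inner_apply_left]
    exact hy)
  rwa [hsr.apply_apply] at this

theorem separationNumber_prod_le (h : IsSimpleSystem W F p s) (l : List (Fin r)) :
    separationNumber W p ((l.map s).prod⁻¹ p) ≤ l.length := by
  induction l using List.reverseRecOn with
  | nil =>
    simp only [List.map_nil, List.prod_nil, inv_one, List.length_nil, nonpos_iff_eq_zero]
    exact h.separationNumber_self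
  | append_singleton l j ih =>
    rw [List.map_append, List.prod_append, List.map_singleton, List.prod_singleton,
      h.mul_inv_apply, List.length_append, List.length_singleton]
    rcases lt_or_gt_of_ne (h.inner_ne (h.prod_mem l) j) with h1 | h1
    · rw [h.separationNumber_apply h1]
      exact Nat.succ_le_succ ih
    · have := h.separationNumber_apply_of_gt h1
      omega

/-- While some wall separates `p` from `σ⁻¹ p`, multiplying `σ` on the right by its reflection
lowers the separation number by one. When none does, `σ⁻¹ p ∈ F` forces `σ = 1`. -/
theorem exists_word (h : IsSimpleSystem W F p s) (n : ℕ) (σ : V ≃ₗᵢ[ℝ] V) (hσ : σ ∈ W)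
    (hn : separationNumber W p (σ⁻¹ p) = n) :
    ∃ l : List (Fin r), l.length = n ∧ (l.map s).prod = σ := by
  have hF := h.isFundamentalDomain
  induction n generalizing σ with
  | zero =>
    refine ⟨[], rfl, ?_⟩
    have hmem : σ⁻¹ p ∈ F := h.mem_of_forall _ fun j => by
      by_contra hlt
      have := h.separationNumber_apply_of_gt (not_le.mp hlt)
      omega
    have h1 := hF.eq_one_of_apply_eq h.mem_interior (W.inv_mem hσ)
      (hF.apply_eq_self (interior_subset h.mem_interior) (W.inv_mem hσ) hmem)
    simpa using (inv_eq_one.mp h1).symm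
  | succ n ih =>
    obtain ⟨j, hj⟩ : ∃ j, inner ℝ p (σ⁻¹ p) < inner ℝ (s j p) (σ⁻¹ p) := by
      by_contra! hcon
      have hmem : σ⁻¹ p ∈ F := h.mem_of_forall _ hcon
      have h1 := hF.apply_eq_self (interior_subset h.mem_interior) (W.inv_mem hσ) hmem
      rw [h1, h.separationNumber_self] at hn
      omega
    have h1 := h.separationNumber_apply_of_gt hj
    obtain ⟨l, hl, hls⟩ := ih (σ * s j) (W.mul_mem hσ (h.mem j)) (by
      rw [h.mul_inv_apply]; omega)
    refine ⟨l ++ [j], by simp [hl], ?_⟩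
    rw [List.map_append, List.prod_append, hls, List.map_singleton, List.prod_singleton,
      mul_assoc, (h.isHyperplaneReflection j).mul_self, mul_one]

theorem wordLength_eq (h : IsSimpleSystem W F p s) {σ : V ≃ₗᵢ[ℝ] V} (hσ : σ ∈ W) :
    wordLength s σ = separationNumber W p (σ⁻¹ p) := by
  have hmem := h.exists_word _ σ hσ rfl
  refine le_antisymm (Nat.sInf_le hmem) (le_csInf ⟨_, hmem⟩ ?_)
  rintro k ⟨l, rfl, rfl⟩
  exact h.separationNumber_prod_le l

/-- The geometric description of the right descent set. -/
theorem mem_rightDescents_iff (h : IsSimpleSystem W F p s) {σ : V ≃ₗᵢ[ℝ] V} (hσ : σ ∈ W)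
    {j : Fin r} : j ∈ rightDescents s σ ↔ inner ℝ p (σ⁻¹ p) < inner ℝ (s j p) (σ⁻¹ p) := by
  rw [rightDescents, Finset.mem_filter, and_iff_right (Finset.mem_univ j),
    h.wordLength_eq hσ, h.wordLength_eq (W.mul_mem hσ (h.mem j)), h.mul_inv_apply]
  rcases lt_or_gt_of_ne (h.inner_ne hσ j) with h1 | h1
  · have := h.separationNumber_apply h1
    exact ⟨fun h2 => by omega, fun h2 => absurd h1 (lt_asymm h2)⟩
  · have := h.separationNumber_apply_of_gt h1
    exact ⟨fun _ => h1, fun _ => by omega⟩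

end IsSimpleSystem

end Length

/-! ### Assigning each point to one chamber -/

section Chambers

variable {V : Type*} [NormedAddCommGroup V] [InnerProductSpace ℝ V]
  {W : Subgroup (V ≃ₗᵢ[ℝ] V)} {F : Set V} {p : V} {r : ℕ} {s : Fin r → V ≃ₗᵢ[ℝ] V}

namespace IsSimpleSystem

theorem apply_eq_of_inner_eq (h : IsSimpleSystem W F p s) {x : V} {j : Fin r}
    (hx : inner ℝ (s j p) x = inner ℝ p x) : s j x = x := by
  obtain ⟨v, c, hc, hv⟩ := (h.isHyperplaneReflection j).inner_sub
  have h1 := (hv p x).1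
  rw [hx, sub_self, eq_comm, mul_eq_zero, or_iff_right hc.ne', mul_eq_zero] at h1
  refine (hv x x).2.mp (h1.resolve_left fun h2 => ?_)
  exact (h.isHyperplaneReflection j).ne_one (h.isFundamentalDomain.eq_one_of_apply_eq
    h.mem_interior (h.mem j) ((hv p p).2.mp h2))

variable [FiniteDimensional ℝ V] [Fintype W]

theorem inner_le_of_mem (h : IsSimpleSystem W F p s) {x : V} (hx : x ∈ F) (j : Fin r) :
    inner ℝ (s j p) x ≤ inner ℝ p x := by
  rw [(h.isHyperplaneReflection j).inner_apply_left, real_inner_comm, real_inner_comm x]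
  exact h.isFundamentalDomain.inner_apply_le_of_mem_interior h.mem_interior hx (h.mem j)

/-- Walls not containing `σ⁻¹ x` survive a small perturbation. For a wall containing it, `j` is no
descent, so the direction `σ⁻¹ p` points to the side of `F`. -/
theorem eventually_apply_mem (h : IsSimpleSystem W F p s) {σ : V ≃ₗᵢ[ℝ] V} (hσ : σ ∈ W) {x : V}
    (hx : σ⁻¹ x ∈ F) (hdes : ∀ j ∈ rightDescents s σ, s j (σ⁻¹ x) ≠ σ⁻¹ x) :
    ∀ᶠ ε : ℝ in 𝓝[>] 0, σ⁻¹ (x + ε • p) ∈ F := by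
  have hev : ∀ᶠ ε : ℝ in 𝓝[>] 0, ∀ j,
      inner ℝ (s j p) (σ⁻¹ (x + ε • p)) ≤ inner ℝ p (σ⁻¹ (x + ε • p)) := by
    rw [eventually_all]
    intro j
    simp only [map_add, map_smul, inner_add_right, real_inner_smul_right]
    rcases (h.inner_le_of_mem hx j).eq_or_lt with h1 | h1
    · have h2 : j ∉ rightDescents s σ := fun hj => hdes j hj (h.apply_eq_of_inner_eq h1)
      rw [h.mem_rightDescents_iff hσ, not_lt] at h2
      filter_upwards [self_mem_nhdsWithin] with ε hε
      exact add_le_add h1.le (mul_le_mul_of_nonneg_left h2 (le_of_lt hε))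
    · have hcont : ∀ a c : ℝ, Tendsto (fun ε : ℝ => a + ε * c) (𝓝[>] 0) (𝓝 a) := fun a c => by
        have hc : Continuous (fun ε : ℝ => a + ε * c) := by fun_prop
        simpa using (hc.tendsto 0).mono_left nhdsWithin_le_nhds
      exact ((hcont _ _).eventually_lt (hcont _ _) h1).mono fun ε hε => hε.le
  exact hev.mono fun ε hε => h.mem_of_forall _ hε

theorem mem_of_frequently (h : IsSimpleSystem W F p s) {σ : V ≃ₗᵢ[ℝ] V} (hσ : σ ∈ W) {x : V}
    (hx : ∃ᶠ ε : ℝ in 𝓝[>] 0, σ⁻¹ (x + ε • p) ∈ F) :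
    σ⁻¹ x ∈ F ∧ ∀ j ∈ rightDescents s σ, s j (σ⁻¹ x) ≠ σ⁻¹ x := by
  constructor
  · have hc : Continuous (fun ε : ℝ => σ⁻¹ (x + ε • p)) :=
      (σ⁻¹).continuous.comp (by fun_prop)
    have ht : Tendsto (fun ε : ℝ => σ⁻¹ (x + ε • p)) (𝓝[>] 0) (𝓝 (σ⁻¹ x)) := by
      simpa using (hc.tendsto 0).mono_left nhdsWithin_le_nhds
    exact h.isFundamentalDomain.isClosed.mem_of_frequently_of_tendsto hx ht
  · intro j hj hfix
    rw [h.mem_rightDescents_iff hσ] at hj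
    obtain ⟨ε, hε, hε0⟩ := (hx.and_eventually self_mem_nhdsWithin).exists
    have h1 := h.inner_le_of_mem hε j
    rw [map_add, map_smul, inner_add_right, inner_add_right, real_inner_smul_right,
      real_inner_smul_right, (h.isHyperplaneReflection j).inner_apply_left p (σ⁻¹ x), hfix,
      add_le_add_iff_left] at h1
    exact absurd (mul_lt_mul_of_pos_left hj hε0) (not_lt.mpr h1)

/-- Every point is the image of a point `y` of the fundamental domain under a unique element
of `W` none of whose right descents fixes `y`. -/
theorem existsUnique_mem (h : IsSimpleSystem W F p s) (x : V) :
    ∃! σ : W, (σ : V ≃ₗᵢ[ℝ] V)⁻¹ x ∈ F ∧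
      ∀ j ∈ rightDescents s (σ : V ≃ₗᵢ[ℝ] V),
        s j ((σ : V ≃ₗᵢ[ℝ] V)⁻¹ x) ≠ (σ : V ≃ₗᵢ[ℝ] V)⁻¹ x := by
  have hF := h.isFundamentalDomain
  -- Each `x + ε • p` lies in some chamber; as `W` is finite, one chamber recurs for arbitrarily
  -- small `ε`.
  obtain ⟨σ, hσ⟩ : ∃ σ : W, ∃ᶠ ε : ℝ in 𝓝[>] 0, (σ : V ≃ₗᵢ[ℝ] V)⁻¹ (x + ε • p) ∈ F := by
    by_contra! hcon
    obtain ⟨ε, hε⟩ := (eventually_all.mpr hcon).exists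
    obtain ⟨τ, hτ, hmem⟩ := hF.exists_apply_mem (x + ε • p)
    exact hε ⟨τ⁻¹, W.inv_mem hτ⟩ (by simpa using hmem)
  refine ⟨σ, h.mem_of_frequently σ.2 hσ, fun τ hτ => ?_⟩
  have h1 := h.eventually_apply_mem τ.2 hτ.1 hτ.2
  have h2 := h.mem_of_frequently σ.2 hσ
  have h3 := h.eventually_apply_mem σ.2 h2.1 h2.2
  have heq : ∀ y : V, (τ : V ≃ₗᵢ[ℝ] V)⁻¹ y ∈ F → (σ : V ≃ₗᵢ[ℝ] V)⁻¹ y ∈ F →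
      (τ : V ≃ₗᵢ[ℝ] V)⁻¹ y = (σ : V ≃ₗᵢ[ℝ] V)⁻¹ y := fun y hy hy' =>
    (hF.2 y).unique ⟨hy, _, W.inv_mem τ.2, rfl⟩ ⟨hy', _, W.inv_mem σ.2, rfl⟩
  -- For a common `ε`, `τ⁻¹` and `σ⁻¹` agree at `x` and at `x + ε • p`, hence at `p`, whose
  -- stabilizer is trivial.
  obtain ⟨ε, ⟨h4, h5⟩, hε⟩ := ((h1.and h3).and self_mem_nhdsWithin).exists
  have h6 := heq _ h4 h5
  rw [map_add, map_add, heq x hτ.1 h2.1, add_right_inj, map_smul, map_smul] at h6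
  have h7 := smul_right_injective V (ne_of_gt hε) h6
  have h8 := hF.eq_one_of_apply_eq (w := (σ : V ≃ₗᵢ[ℝ] V) * (τ : V ≃ₗᵢ[ℝ] V)⁻¹) h.mem_interior
    (W.mul_mem σ.2 (W.inv_mem τ.2)) (by
      change (σ : V ≃ₗᵢ[ℝ] V) ((τ : V ≃ₗᵢ[ℝ] V)⁻¹ p) = p
      rw [h7, apply_inv_self])
  exact Subtype.ext (mul_inv_eq_one.mp h8).symm

end IsSimpleSystem

end Chambers

/-! ### Lattice bases and their enumeration by walls -/

section PrimitiveGenerators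

variable {V : Type*} [NormedAddCommGroup V] [InnerProductSpace ℝ V]

theorem IsPrimitiveGenerators.exists_basis [FiniteDimensional ℝ V] {Γ : Submodule ℤ V}
    [DiscreteTopology Γ] [IsZLattice ℝ Γ] {K : Set V} {m : ℕ} {b : Fin m → V}
    (h : IsPrimitiveGenerators Γ K b) :
    ∃ B : Module.Basis (Fin m) ℝ V, (∀ i, B i = b i) ∧ K = {x | ∀ i, 0 ≤ B.coord i x} ∧
      ∀ x, x ∈ Γ ↔ ∀ i, ∃ n : ℤ, B.coord i x = n := by
  let B₀ : Module.Basis (Fin m) ℤ Γ :=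
    (Module.Basis.span h.linearIndependent).map (LinearEquiv.ofEq _ _ h.span_eq)
  let B := B₀.ofZLatticeBasis ℝ Γ
  have hB : ∀ i, B i = b i := fun i => by
    rw [Module.Basis.ofZLatticeBasis_apply, Module.Basis.map_apply, LinearEquiv.coe_ofEq_apply,
      Module.Basis.span_apply]
  refine ⟨B, hB, ?_, fun x => ?_⟩
  · rw [h.cone_eq]
    ext x
    constructor
    · rintro ⟨c, hc, rfl⟩ i
      have : B.coord i (∑ j, c j • b j) = c i := by
        simp only [← hB, B.coord_apply, B.repr_sum_self]
      rw [this]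
      exact hc i
    · intro hx
      refine ⟨fun i => B.coord i x, hx, ?_⟩
      simp only [← hB, B.coord_apply, B.sum_repr]
  · have hspan : Submodule.span ℤ (Set.range B) = Γ := B₀.ofZLatticeBasis_span ℝ
    rw [← hspan, Module.Basis.mem_span_iff_repr_mem]
    simp [eq_comm]

theorem IsPrimitiveGenerators.comp_equiv {Γ : Submodule ℤ V} {K : Set V} {m n : ℕ}
    {b : Fin m → V} (h : IsPrimitiveGenerators Γ K b) (e : Fin n ≃ Fin m) :
    IsPrimitiveGenerators Γ K (b ∘ e) where
  linearIndependent := h.linearIndependent.comp _ e.injective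
  span_eq := by rw [Set.range_comp, e.range_eq_univ, Set.image_univ, h.span_eq]
  cone_eq := by
    rw [h.cone_eq]
    ext x
    constructor
    · rintro ⟨c, hc, rfl⟩
      exact ⟨c ∘ e, fun j => hc _, (Equiv.sum_comp e fun j => c j • b j).symm⟩
    · rintro ⟨c, hc, rfl⟩
      refine ⟨c ∘ e.symm, fun j => hc _, ?_⟩
      rw [← Equiv.sum_comp e]
      simp

theorem coord_basis_eq_zero_iff {ι : Type*} (B : Module.Basis ι ℝ V) (i j : ι) :
    B.coord i (B j) = 0 ↔ j ≠ i := by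
  classical
  rw [B.coord_apply, B.repr_self, Finsupp.single_apply]
  simp

theorem ker_coord_injective {ι : Type*} (B : Module.Basis ι ℝ V) :
    Function.Injective fun i => LinearMap.ker (B.coord i) := fun i j hij => by
  by_contra hne
  have h1 : B j ∈ LinearMap.ker (B.coord i) := (coord_basis_eq_zero_iff B i j).mpr (Ne.symm hne)
  have h2 : B j ∈ LinearMap.ker (B.coord j) := by
    simp only at hij
    rwa [hij] at h1
  exact (coord_basis_eq_zero_iff B j j).mp h2 rfl

/-- An injective enumeration of the facet hyperplanes belongs to an enumeration of the basis in
which the exceptional index comes last. -/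
theorem exists_equiv_of_range_eq {ι : Type*} (B : Module.Basis ι ℝ V) (k₀ : ι) {r : ℕ}
    {H : Fin r → Submodule ℝ V} (hH : Function.Injective H)
    (hrange : ∀ L, L ∈ Set.range H ↔ ∃ i, i ≠ k₀ ∧ L = LinearMap.ker (B.coord i)) :
    ∃ e : Fin (r + 1) ≃ ι, e (Fin.last r) = k₀ ∧
      ∀ j : Fin r, H j = LinearMap.ker (B.coord (e j.castSucc)) := by
  choose τ hτ₀ hτ using fun j => (hrange (H j)).mp ⟨j, rfl⟩
  have hτinj : Function.Injective τ := fun i j hij => hH (by rw [hτ i, hτ j, hij])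
  let e : Fin (r + 1) → ι := Fin.snoc (α := fun _ => ι) τ k₀
  have he : Function.Bijective e := by
    constructor
    · intro i j
      refine Fin.lastCases ?_ (fun i => ?_) i <;> refine Fin.lastCases ?_ (fun j => ?_) j
      · exact fun _ => rfl
      · simp only [e, Fin.snoc_last, Fin.snoc_castSucc]
        exact fun h => absurd h.symm (hτ₀ j)
      · simp only [e, Fin.snoc_last, Fin.snoc_castSucc]
        exact fun h => absurd h (hτ₀ i)
      · simp only [e, Fin.snoc_castSucc]
        exact fun h => congrArg _ (hτinj h)
    · intro i
      by_cases hi : i = k₀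
      · exact ⟨Fin.last r, by simp only [e, Fin.snoc_last, hi]⟩
      · obtain ⟨j, hj⟩ := (hrange _).mpr ⟨i, hi, rfl⟩
        refine ⟨j.castSucc, ?_⟩
        simp only [e, Fin.snoc_castSucc]
        exact ker_coord_injective B ((hτ j).symm.trans hj)
  refine ⟨Equiv.ofBijective e he, ?_, fun j => ?_⟩
  · simp [e]
  · simpa [e] using hτ j

end PrimitiveGenerators

section AdaptedBases

variable {V : Type*} [NormedAddCommGroup V] [InnerProductSpace ℝ V]

/-- The basis `B` of the lattice `Γ` generates the cone `C ∩ F`, and its dual basis consists of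
the forms defining the walls `H j` of the fundamental domain `F` and of a multiple of the
form `ψ`. -/
structure IsAdaptedBasis (W : Subgroup (V ≃ₗᵢ[ℝ] V)) (Γ : Submodule ℤ V) (C F : Set V)
    (ψ : Module.Dual ℝ V) (p : V) {r : ℕ} (H : Fin r → Submodule ℝ V)
    (B : Module.Basis (Fin (r + 1)) ℝ V) : Prop where
  cone_eq : C ∩ F = {x | ∀ i, 0 ≤ B.coord i x}
  mem_lattice_iff : ∀ x, x ∈ Γ ↔ ∀ i, ∃ n : ℤ, B.coord i x = n
  form_eq : ∃ c : ℝ, 0 < c ∧ ψ = c • B.coord (Fin.last r)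
  mem_iff : ∀ x, x ∈ F ↔ ∀ j : Fin r, 0 ≤ B.coord j.castSucc x
  ker_eq : ∀ j, H j = LinearMap.ker (B.coord j.castSucc)
  exists_reflection : ∀ j : Fin r, ∃ t ∈ W, IsHyperplaneReflection t ∧
    (∀ x, t x = x ↔ B.coord j.castSucc x = 0) ∧
    ∃ c : ℝ, 0 < c ∧ ∀ x, inner ℝ p x - inner ℝ (t p) x = c * B.coord j.castSucc x

variable {W : Subgroup (V ≃ₗᵢ[ℝ] V)} {Γ : Submodule ℤ V} {C F : Set V}
  {ψ : Module.Dual ℝ V} {p : V} {r : ℕ} {H : Fin r → Submodule ℝ V}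

theorem IsPrimitiveGenerators.exists_adaptedBasis [FiniteDimensional ℝ V] [Finite W]
    [DiscreteTopology Γ] [IsZLattice ℝ Γ]
    (hF : IsFundamentalDomain W F) (hp : p ∈ interior F) {v : V} (hv : ∀ σ ∈ W, σ v = v)
    (hψv : 0 < ψ v) (hCF : C ∩ F = {x | x ∈ F ∧ 0 ≤ ψ x}) (hH : Function.Injective H)
    (hHF : Set.range H = {L | IsFacetHyperplane F L}) {b : Fin (r + 1) → V}
    (hb : IsPrimitiveGenerators Γ (C ∩ F) b) (hbH : ∀ j : Fin r, b j.castSucc ∉ H j) :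
    ∃ B : Module.Basis (Fin (r + 1)) ℝ V, (∀ i, B i = b i) ∧ IsAdaptedBasis W Γ C F ψ p H B := by
  obtain ⟨B, hB, hcone, hlat⟩ := hb.exists_basis
  obtain ⟨k₀, hform, hmem, hrefl⟩ := hF.exists_facet_index hp hv hψv hCF B hcone
  obtain ⟨e, he₀, he⟩ := exists_equiv_of_range_eq B k₀ hH fun L => by
    rw [hHF, ← isFacetHyperplane_iff B k₀ hmem]
    rfl
  -- A basis vector lies outside the kernel of its own coordinate only, so `b_j ∉ H j` forces the
  -- enumeration of the walls to be the given one.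
  have he' : ∀ j : Fin r, e j.castSucc = j.castSucc := fun j => by
    have := hbH j
    rw [he, ← hB, LinearMap.mem_ker, coord_basis_eq_zero_iff, not_not] at this
    exact this.symm
  have hk₀ : k₀ = Fin.last r := by
    induction k₀ using Fin.lastCases with
    | last => rfl
    | cast j =>
      rw [← he' j] at he₀
      exact absurd (e.injective he₀) (Fin.castSucc_ne_last j).symm
  subst hk₀
  refine ⟨B, hB, hcone, hlat, hform, fun x => ?_, fun j => ?_, fun j => ?_⟩
  · rw [hmem, Fin.forall_fin_succ']
    simp [Fin.castSucc_ne_last]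
  · rw [he, he']
  · exact hrefl _ (Fin.castSucc_ne_last j)

theorem IsUnimodularCone.exists_primitiveGenerators [FiniteDimensional ℝ V] [Finite W]
    [DiscreteTopology Γ] [IsZLattice ℝ Γ]
    (hu : IsUnimodularCone Γ (C ∩ F)) (hF : IsFundamentalDomain W F) {v : V}
    (hv : ∀ σ ∈ W, σ v = v) (hψv : 0 < ψ v) (hCF : C ∩ F = {x | x ∈ F ∧ 0 ≤ ψ x})
    (hH : Function.Injective H) (hHF : Set.range H = {L | IsFacetHyperplane F L}) :
    ∃ b : Fin (r + 1) → V, IsPrimitiveGenerators Γ (C ∩ F) b ∧ ∀ j : Fin r, b j.castSucc ∉ H j := by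
  obtain ⟨m, b, hb⟩ := hu
  obtain ⟨p, hp⟩ := hF.exists_mem_interior
  obtain ⟨B, hB, hcone, -⟩ := hb.exists_basis
  obtain ⟨k₀, -, hmem, -⟩ := hF.exists_facet_index hp hv hψv hCF B hcone
  obtain ⟨e, -, he⟩ := exists_equiv_of_range_eq B k₀ hH fun L => by
    rw [hHF, ← isFacetHyperplane_iff B k₀ hmem]
    rfl
  refine ⟨b ∘ e, hb.comp_equiv e, fun j => ?_⟩
  rw [he, Function.comp_apply, ← hB, LinearMap.mem_ker, coord_basis_eq_zero_iff, not_not]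

namespace IsAdaptedBasis

variable {B B' : Module.Basis (Fin (r + 1)) ℝ V}

theorem basis_mem (h : IsAdaptedBasis W Γ C F ψ p H B) (i : Fin (r + 1)) :
    B i ∈ C ∩ F ∧ B i ∈ Γ := by
  classical
  constructor
  · rw [h.cone_eq]
    intro k
    rw [B.coord_apply, B.repr_self, Finsupp.single_apply]
    split_ifs <;> norm_num
  · rw [h.mem_lattice_iff]
    intro k
    rw [B.coord_apply, B.repr_self, Finsupp.single_apply]
    split_ifs
    · exact ⟨1, by norm_num⟩
    · exact ⟨0, by norm_num⟩

/-- Up to positive scalars or equality of kernels, both dual bases consist of `ψ` and the forms of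
the walls in the same order. So all coordinates of `B' i` but the `i`-th vanish, and that one is
integral. -/
theorem exists_eq_smul (h : IsAdaptedBasis W Γ C F ψ p H B)
    (h' : IsAdaptedBasis W Γ C F ψ p H B') (i : Fin (r + 1)) :
    ∃ n : ℤ, 0 ≤ n ∧ B' i = (n : ℝ) • B i := by
  obtain ⟨n, hn⟩ := (h.mem_lattice_iff _).mp (h'.basis_mem i).2 i
  have hnn : 0 ≤ B.coord i (B' i) := by
    have := (h'.basis_mem i).1
    rw [h.cone_eq] at this
    exact this i
  refine ⟨n, by rw [hn] at hnn; exact_mod_cast hnn, ?_⟩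
  have hzero : ∀ k, k ≠ i → B.coord k (B' i) = 0 := fun k hk => by
    have hz := (coord_basis_eq_zero_iff B' k i).mpr hk.symm
    induction k using Fin.lastCases with
    | last =>
      obtain ⟨c, hc, hψ⟩ := h.form_eq
      obtain ⟨c', -, hψ'⟩ := h'.form_eq
      have h1 : c • B.coord (Fin.last r) (B' i) = c' • B'.coord (Fin.last r) (B' i) := by
        rw [← LinearMap.smul_apply, ← LinearMap.smul_apply, ← hψ, ← hψ']
      rw [hz, smul_zero, smul_eq_mul, mul_eq_zero] at h1
      exact h1.resolve_left hc.ne'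
    | cast j =>
      have h1 : B' i ∈ H j := by rw [h'.ker_eq]; exact hz
      rw [h.ker_eq] at h1
      exact h1
  refine B.ext_elem fun k => ?_
  rw [map_smul, Finsupp.smul_apply, B.repr_self]
  by_cases hk : k = i
  · subst hk
    rw [Finsupp.single_eq_same, smul_eq_mul, mul_one, ← hn, B.coord_apply]
  · rw [Finsupp.single_eq_of_ne hk, smul_zero, ← B.coord_apply, hzero k hk]

theorem basis_eq (h : IsAdaptedBasis W Γ C F ψ p H B)
    (h' : IsAdaptedBasis W Γ C F ψ p H B') (i : Fin (r + 1)) : B' i = B i := by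
  obtain ⟨n, hn, hB'⟩ := h.exists_eq_smul h' i
  obtain ⟨n', hn', hB⟩ := h'.exists_eq_smul h i
  have h1 : B i = ((n' : ℝ) * n) • B i := by rw [mul_smul, ← hB', ← hB]
  have h2 : ((n' : ℝ) * n - 1) • B i = 0 := by rw [sub_smul, one_smul, ← h1, sub_self]
  have h3 : (n' : ℝ) * n = 1 :=
    sub_eq_zero.mp ((smul_eq_zero.mp h2).resolve_right (B.ne_zero i))
  have h4 : n' * n = 1 := by exact_mod_cast h3
  have h5 : n = 1 := Int.eq_one_of_mul_eq_one_left hn h4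
  rw [hB', h5, Int.cast_one, one_smul]

variable [FiniteDimensional ℝ V]

theorem reflection_apply_eq_iff (h : IsAdaptedBasis W Γ C F ψ p H B) (j : Fin r) (x : V) :
    (H j).reflection x = x ↔ B.coord j.castSucc x = 0 := by
  rw [Submodule.reflection_eq_self_iff, h.ker_eq, LinearMap.mem_ker]

theorem isSimpleSystem (h : IsAdaptedBasis W Γ C F ψ p H B) (hF : IsFundamentalDomain W F)
    (hp : p ∈ interior F) (hHF : Set.range H = {L | IsFacetHyperplane F L}) :
    IsSimpleSystem W F p fun j => (H j).reflection := by
  have key : ∀ j : Fin r, (H j).reflection ∈ W ∧ IsHyperplaneReflection (H j).reflection ∧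
      ∃ c : ℝ, 0 < c ∧ ∀ x, inner ℝ p x - inner ℝ ((H j).reflection p) x
        = c * B.coord j.castSucc x := fun j => by
    obtain ⟨t, ht, hr, hfix, hc⟩ := h.exists_reflection j
    have : t = (H j).reflection := hr.eq_reflection fun x => by
      rw [hfix, h.ker_eq, LinearMap.mem_ker]
    subst this
    exact ⟨ht, hr, hc⟩
  refine ⟨hF, hp, fun j => (key j).1, fun j => (key j).2.1, fun x hx => ?_, fun j x hx => ?_⟩
  · rw [h.mem_iff]
    intro j
    obtain ⟨c, hc, hcx⟩ := (key j).2.2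
    have h1 := hcx x
    have h2 := hx j
    exact nonneg_of_mul_nonneg_right (by linarith) hc
  · have hfacet : IsFacetHyperplane F (H j) := by
      have : H j ∈ Set.range H := ⟨j, rfl⟩
      rwa [hHF] at this
    rw [Submodule.reflection_eq_self_iff, ← hfacet.2] at hx
    convert hx using 2
    ext y
    simp only [Submodule.reflection_eq_self_iff]
    rfl

end IsAdaptedBasis

end AdaptedBases

/-! ### Multiple geometric series -/

section Series

/-- The product of finitely many absolutely convergent series. -/
theorem hasSum_pi_prod {n : ℕ} {f : Fin n → ℕ → ℂ} {a : Fin n → ℂ}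
    (hf : ∀ j, HasSum (f j) (a j)) (hn : ∀ j, Summable fun k => ‖f j k‖) :
    HasSum (fun c : Fin n → ℕ => ∏ j, f j (c j)) (∏ j, a j) ∧
      Summable fun c : Fin n → ℕ => ‖∏ j, f j (c j)‖ := by
  -- Norm summability is carried along because the product of two series requires it.
  induction n with
  | zero =>
    simp only [Finset.univ_eq_empty, Finset.prod_empty]
    exact ⟨hasSum_unique _, (hasSum_unique _).summable⟩
  | succ n ih =>
    obtain ⟨h1, h2⟩ := ih (fun j => hf j.succ) fun j => hn j.succ
    have h3 := (hn 0).mul_norm h2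
    have h4 := (hf 0).mul h1 h3.of_norm
    rw [← (Fin.consEquiv fun _ => ℕ).hasSum_iff, ← (Fin.consEquiv fun _ => ℕ).summable_iff]
    simp only [Fin.prod_univ_succ, Function.comp_def, Fin.consEquiv_apply, Fin.cons_zero,
      Fin.cons_succ]
    exact ⟨h4, h3⟩

/-- Dropping the term of exponent zero when `P` holds turns `1 / (1 - z)` into `z / (1 - z)`; this
is the source of the descent factors. -/
theorem hasSum_geometric_ite {z : ℂ} (hz : ‖z‖ < 1) (P : Prop) [Decidable P] :
    HasSum (fun k : ℕ => if P ∧ k = 0 then 0 else z ^ k) ((if P then z else 1) / (1 - z)) ∧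
      Summable fun k : ℕ => ‖if P ∧ k = 0 then 0 else z ^ k‖ := by
  have hsum := hasSum_geometric_of_norm_lt_one hz
  have h1 : (1 - z) ≠ 0 := fun h => by
    rw [sub_eq_zero] at h
    rw [← h, norm_one] at hz
    exact lt_irrefl _ hz
  constructor
  · by_cases hP : P
    · simp only [hP, true_and, if_true]
      rw [← hasSum_nat_add_iff' 1]
      simp only [Nat.add_eq_zero_iff, one_ne_zero, and_false, if_false, Finset.range_one,
        Finset.sum_singleton, if_true, sub_zero]
      simpa only [pow_succ', div_eq_mul_inv] using hsum.mul_left z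
    · simpa only [hP, false_and, if_false, one_div] using hsum
  · refine Summable.of_nonneg_of_le (fun _ => norm_nonneg _) (fun k => ?_)
      (summable_geometric_of_lt_one (norm_nonneg z) hz)
    split_ifs
    · rw [norm_zero]
      positivity
    · rw [norm_pow]

/-- The multiple geometric series over all exponents that are positive on `D`. -/
theorem hasSum_pi_geometric {n : ℕ} {z : Fin n → ℂ} (hz : ∀ j, ‖z j‖ < 1) (D : Finset (Fin n)) :
    HasSum (fun c : Fin n → ℕ => if ∀ j ∈ D, c j ≠ 0 then ∏ j, z j ^ c j else 0)
      ((∏ j ∈ D, z j) / ∏ j, (1 - z j)) := by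
  have h := (hasSum_pi_prod (fun j => (hasSum_geometric_ite (hz j) (j ∈ D)).1)
    fun j => (hasSum_geometric_ite (hz j) (j ∈ D)).2).1
  rw [Finset.prod_div_distrib, Finset.prod_ite_mem, Finset.univ_inter] at h
  convert h using 2 with c
  split_ifs with hc
  · refine Finset.prod_congr rfl fun j _ => ?_
    rw [if_neg fun h0 => hc j h0.1 h0.2]
  · push Not at hc
    obtain ⟨j, hj, hcj⟩ := hc
    refine (Finset.prod_eq_zero (Finset.mem_univ j) ?_).symm
    rw [if_pos ⟨hj, hcj⟩]

end Series

/-! ### Meromorphy of the right-hand side -/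

section Meromorphic

theorem isMeromorphic_sum_div {E : Type*} [NormedAddCommGroup E] [NormedSpace ℂ E] {ι : Type*}
    [Fintype ι] {N D : ι → E → ℂ} (hN : ∀ i z, AnalyticAt ℂ (N i) z)
    (hD : ∀ i z, AnalyticAt ℂ (D i) z) (hdense : Dense {z | ∀ i, D i z ≠ 0}) :
    IsMeromorphic fun z => ∑ i, N i z / D i z := by
  classical
  intro z
  refine ⟨fun w => ∑ i, N i w * ∏ k ∈ Finset.univ.erase i, D k w, fun w => ∏ i, D i w,
    Finset.analyticAt_fun_sum _ fun i _ => (hN i z).mul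
      (Finset.analyticAt_fun_prod _ fun k _ => hD k z),
    Finset.analyticAt_fun_prod _ fun k _ => hD k z, ?_, ?_⟩
  · have h1 := mem_closure_iff_frequently.mp (hdense z)
    intro h2
    obtain ⟨w, hw, hw0⟩ := (h1.and_eventually h2).exists
    exact Finset.prod_ne_zero_iff.mpr (fun i _ => hw i) hw0
  · refine Eventually.of_forall fun w hw => ?_
    rw [Finset.sum_div]
    refine Finset.sum_congr rfl fun i _ => ?_
    have hi : ∀ i, D i w ≠ 0 := fun i => Finset.prod_ne_zero_iff.mp hw i (Finset.mem_univ i)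
    change _ = _ / ∏ i, D i w
    rw [← Finset.mul_prod_erase _ _ (Finset.mem_univ i), mul_div_mul_right]
    exact Finset.prod_ne_zero_iff.mpr fun k _ => hi k

variable {V : Type*} [NormedAddCommGroup V] [InnerProductSpace ℝ V]

/-- Evaluation at `v`, as a complex linear form on the complexified dual of `V`. -/
noncomputable def evalCLM (v : V) : (V →L[ℝ] ℂ) →L[ℂ] ℂ :=
  LinearMap.mkContinuous
    { toFun := fun φ => φ v
      map_add' := fun _ _ => rfl
      map_smul' := fun _ _ => rfl } ‖v‖ fun φ => by
    rw [mul_comm]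
    exact φ.le_opNorm v

theorem analyticAt_cexp_neg_apply (v : V) (φ : V →L[ℝ] ℂ) :
    AnalyticAt ℂ (fun φ : V →L[ℝ] ℂ => Complex.exp (-φ v)) φ :=
  ((evalCLM v).analyticAt φ).neg.cexp

theorem dense_cexp_ne_one {v : V} (hv : v ≠ 0) :
    Dense {φ : V →L[ℝ] ℂ | 1 - Complex.exp (-φ v) ≠ 0} := by
  intro φ
  by_cases h : 1 - Complex.exp (-φ v) ≠ 0
  · exact subset_closure h
  rw [not_not, sub_eq_zero, eq_comm] at h
  -- A move by `ε • η` multiplies `exp (-φ v) = 1` by `exp (-ε ‖v‖²)`, which is not `1`.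
  let η : V →L[ℝ] ℂ := Complex.ofRealCLM.comp (innerSL ℝ v)
  have hη : η v = ((‖v‖ ^ 2 : ℝ) : ℂ) := by
    change ((inner ℝ v v : ℝ) : ℂ) = _
    rw [real_inner_self_eq_norm_sq]
  have ht : Tendsto (fun ε : ℝ => φ + ε • η) (𝓝[>] 0) (𝓝 φ) := by
    have hc : Continuous (fun ε : ℝ => φ + ε • η) := by fun_prop
    have h0 : φ + (0 : ℝ) • η = φ := by rw [zero_smul ℝ η, add_zero]
    have := (hc.tendsto 0).mono_left (nhdsWithin_le_nhds (s := Set.Ioi 0))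
    rwa [h0] at this
  refine mem_closure_of_tendsto ht ?_
  filter_upwards [self_mem_nhdsWithin] with ε hε
  have hε : (0 : ℝ) < ε := hε
  change 1 - Complex.exp (-(φ v + ε • η v)) ≠ 0
  rw [neg_add, Complex.exp_add, h, one_mul, sub_ne_zero, hη, Complex.real_smul,
    ← Complex.ofReal_mul, ← Complex.ofReal_neg, ← Complex.ofReal_exp, ne_comm]
  intro h1
  have h2 : Real.exp (-(ε * ‖v‖ ^ 2)) = 1 := by exact_mod_cast h1
  rw [Real.exp_eq_one_iff] at h2
  have : 0 < ε * ‖v‖ ^ 2 := by positivity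
  linarith

theorem dense_forall_cexp_ne_one {ι : Type*} [Finite ι] {v : ι → V} (hv : ∀ i, v i ≠ 0) :
    Dense {φ : V →L[ℝ] ℂ | ∀ i, 1 - Complex.exp (-φ (v i)) ≠ 0} := by
  have := dense_iInter_of_isOpen (f := fun i => {φ : V →L[ℝ] ℂ | 1 - Complex.exp (-φ (v i)) ≠ 0})
    (fun i => isOpen_ne_fun (by fun_prop) continuous_const) fun i => dense_cexp_ne_one (hv i)
  rwa [← Set.ofPred_forall] at this

end Meromorphic

/-! ### Summation over chambers and convergence -/

section GeneratingFunction

variable {V : Type*} [NormedAddCommGroup V] [InnerProductSpace ℝ V]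
  {W : Subgroup (V ≃ₗᵢ[ℝ] V)} {Γ : Submodule ℤ V} {C F : Set V}
  {ψ : Module.Dual ℝ V} {p : V} {r : ℕ} {H : Fin r → Submodule ℝ V}
  {B : Module.Basis (Fin (r + 1)) ℝ V}

theorem cexp_natCombination (φ : V →L[ℝ] ℂ) (σ : V ≃ₗᵢ[ℝ] V) (c : Fin (r + 1) → ℕ) :
    Complex.exp (-φ (σ (∑ i, (c i : ℝ) • B i))) = ∏ i, Complex.exp (-φ (σ (B i))) ^ c i := by
  rw [map_sum, map_sum, ← Finset.sum_neg_distrib, Complex.exp_sum]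
  refine Finset.prod_congr rfl fun i _ => ?_
  rw [← Complex.exp_nat_mul, map_smul, map_smul, Complex.real_smul]
  congr 1
  push_cast
  ring

namespace IsAdaptedBasis

theorem natCombination_mem (h : IsAdaptedBasis W Γ C F ψ p H B) (c : Fin (r + 1) → ℕ) :
    ∑ i, (c i : ℝ) • B i ∈ C ∩ F ∧ ∑ i, (c i : ℝ) • B i ∈ Γ := by
  have hcoord : ∀ i, B.coord i (∑ i, (c i : ℝ) • B i) = c i := fun i => by
    rw [B.coord_apply, B.repr_sum_self]
  rw [h.cone_eq, h.mem_lattice_iff]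
  exact ⟨fun i => by rw [hcoord]; positivity, fun i => ⟨c i, by rw [hcoord]; rfl⟩⟩

theorem exists_natCombination (h : IsAdaptedBasis W Γ C F ψ p H B) {x : V} (hx : x ∈ C ∩ F)
    (hxΓ : x ∈ Γ) : ∃ c : Fin (r + 1) → ℕ, x = ∑ i, (c i : ℝ) • B i := by
  rw [h.cone_eq] at hx
  have : ∀ i, ∃ k : ℕ, B.coord i x = k := fun i => by
    obtain ⟨n, hn⟩ := (h.mem_lattice_iff x).mp hxΓ i
    have h0 : 0 ≤ n := by
      have := hx i
      rw [hn] at this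
      exact_mod_cast this
    refine ⟨n.toNat, ?_⟩
    rw [hn]
    exact_mod_cast (Int.toNat_of_nonneg h0).symm
  choose c hc using this
  refine ⟨c, ?_⟩
  simp only [← hc, B.coord_apply, B.sum_repr]

variable [FiniteDimensional ℝ V] [Fintype W]

/-- The lattice points of the cone are counted by summing over the chambers `σ F`, where a point
in several chambers is counted in the one that meets none of its right descents. -/
theorem hasSum_cexp (h : IsAdaptedBasis W Γ C F ψ p H B)
    (hs : IsSimpleSystem W F p fun j => (H j).reflection)
    (hΓ : ∀ σ ∈ W, ∀ x ∈ Γ, σ x ∈ Γ) (hC : ∀ σ ∈ W, ∀ x ∈ C, σ x ∈ C) {φ : V →L[ℝ] ℂ}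
    (hφ : ∀ σ ∈ W, ∀ i, 0 < (φ (σ (B i))).re) :
    HasSum (fun x : ↥(C ∩ (Γ : Set V)) => Complex.exp (-φ (x : V)))
      (∑ σ : W, (∏ j ∈ rightDescents (fun i => (H i).reflection) (σ : V ≃ₗᵢ[ℝ] V),
              Complex.exp (-φ ((σ : V ≃ₗᵢ[ℝ] V) (B j.castSucc)))) /
            ∏ j : Fin (r + 1), (1 - Complex.exp (-φ ((σ : V ≃ₗᵢ[ℝ] V) (B j))))) := by
  classical
  let good : W → V → Prop := fun σ x => (σ : V ≃ₗᵢ[ℝ] V)⁻¹ x ∈ F ∧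
    ∀ j ∈ rightDescents (fun i => (H i).reflection) (σ : V ≃ₗᵢ[ℝ] V),
      (H j).reflection ((σ : V ≃ₗᵢ[ℝ] V)⁻¹ x) ≠ (σ : V ≃ₗᵢ[ℝ] V)⁻¹ x
  have hchamber : ∀ σ : W, HasSum
      (fun x : ↥(C ∩ (Γ : Set V)) => if good σ x then Complex.exp (-φ (x : V)) else 0)
      ((∏ j ∈ rightDescents (fun i => (H i).reflection) (σ : V ≃ₗᵢ[ℝ] V),
              Complex.exp (-φ ((σ : V ≃ₗᵢ[ℝ] V) (B j.castSucc)))) /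
            ∏ j : Fin (r + 1), (1 - Complex.exp (-φ ((σ : V ≃ₗᵢ[ℝ] V) (B j))))) := by
    intro σ
    let D := (rightDescents (fun i => (H i).reflection) (σ : V ≃ₗᵢ[ℝ] V)).map Fin.castSuccEmb
    have hz : ∀ j, ‖Complex.exp (-φ ((σ : V ≃ₗᵢ[ℝ] V) (B j)))‖ < 1 := fun j => by
      rw [Complex.norm_exp, Real.exp_lt_one_iff, Complex.neg_re, neg_lt_zero]
      exact hφ σ σ.2 j
    have hgeom := hasSum_pi_geometric hz D
    rw [Finset.prod_map] at hgeom
    simp only [Fin.coe_castSuccEmb] at hgeom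
    -- `g` parametrizes the lattice points of the chamber `σ (C ∩ F)`. Since `s j` fixes a point
    -- exactly if its `j`-th coordinate vanishes, `good` becomes positivity of the exponents on `D`.
    let g : (Fin (r + 1) → ℕ) → ↥(C ∩ (Γ : Set V)) := fun c =>
      ⟨(σ : V ≃ₗᵢ[ℝ] V) (∑ i, (c i : ℝ) • B i),
        hC σ σ.2 _ (h.natCombination_mem c).1.1, hΓ σ σ.2 _ (h.natCombination_mem c).2⟩
    have hcoord : ∀ c : Fin (r + 1) → ℕ, ∀ i, B.coord i (∑ i, (c i : ℝ) • B i) = c i :=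
      fun c i => by rw [B.coord_apply, B.repr_sum_self]
    have hg : Function.Injective g := fun c d hcd => by
      have h1 := (σ : V ≃ₗᵢ[ℝ] V).injective (congrArg Subtype.val hcd)
      funext i
      have h2 := congrArg (B.coord i) h1
      rw [hcoord, hcoord] at h2
      exact_mod_cast h2
    rw [← hg.hasSum_iff]
    · convert hgeom using 2 with c
      have hinv : (σ : V ≃ₗᵢ[ℝ] V)⁻¹ (g c : V) = ∑ i, (c i : ℝ) • B i := inv_apply_self _ _
      have hiff : good σ (g c) ↔ ∀ j ∈ D, c j ≠ 0 := by
        simp only [good, hinv, D, Finset.mem_map, forall_exists_index, and_imp,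
          forall_apply_eq_imp_iff₂, (h.natCombination_mem c).1.2, true_and, ne_eq,
          h.reflection_apply_eq_iff, hcoord, Nat.cast_eq_zero, Fin.coe_castSuccEmb]
      rw [Function.comp_apply]
      simp only [hiff]
      rw [cexp_natCombination]
    · intro x hx
      refine if_neg fun hgood => hx ?_
      obtain ⟨c, hc⟩ := h.exists_natCombination
        ⟨hC _ (W.inv_mem σ.2) _ x.2.1, hgood.1⟩ (hΓ _ (W.inv_mem σ.2) _ x.2.2)
      refine ⟨c, Subtype.ext ?_⟩
      change (σ : V ≃ₗᵢ[ℝ] V) (∑ i, (c i : ℝ) • B i) = x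
      rw [← hc, apply_inv_self]
  have hsum := hasSum_sum (s := Finset.univ) fun (σ : W) _ => hchamber σ
  convert hsum using 2 with x
  obtain ⟨σ, hσ, huniq⟩ := hs.existsUnique_mem (x : V)
  rw [Finset.sum_eq_single σ, if_pos hσ]
  · exact fun τ _ hne => if_neg fun hτ => hne (huniq τ hτ)
  · exact fun h0 => absurd (Finset.mem_univ σ) h0

theorem isGeneratingFunction (h : IsAdaptedBasis W Γ C F ψ p H B)
    (hs : IsSimpleSystem W F p fun j => (H j).reflection)
    (hΓ : ∀ σ ∈ W, ∀ x ∈ Γ, σ x ∈ Γ) (hC : C = {x | ∀ σ ∈ W, 0 ≤ ψ (σ x)})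
    (hψ : ∀ x, (∀ σ ∈ W, ψ (σ x) = 0) → x = 0) :
    IsGeneratingFunction Γ C fun φ =>
      ∑ σ : W, (∏ j ∈ rightDescents (fun i => (H i).reflection) (σ : V ≃ₗᵢ[ℝ] V),
              Complex.exp (-φ ((σ : V ≃ₗᵢ[ℝ] V) (B j.castSucc)))) /
            ∏ j : Fin (r + 1), (1 - Complex.exp (-φ ((σ : V ≃ₗᵢ[ℝ] V) (B j)))) := by
  have hinv : ∀ σ ∈ W, ∀ x ∈ C, σ x ∈ C := by
    rw [hC]
    exact fun σ hσ x hx τ hτ => hx (τ * σ) (W.mul_mem hτ hσ)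
  constructor
  · refine isMeromorphic_sum_div
      (fun σ φ => Finset.analyticAt_fun_prod _ fun j _ => analyticAt_cexp_neg_apply _ φ)
      (fun σ φ => Finset.analyticAt_fun_prod _ fun j _ =>
        analyticAt_const.sub (analyticAt_cexp_neg_apply _ φ)) ?_
    have hne : ∀ i : W × Fin (r + 1), (i.1 : V ≃ₗᵢ[ℝ] V) (B i.2) ≠ 0 := fun i => by
      simpa using B.ne_zero i.2
    refine (dense_forall_cexp_ne_one hne).mono fun φ hφ σ => ?_
    exact Finset.prod_ne_zero_iff.mpr fun j _ => hφ (σ, j)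
  -- `L` is `W`-invariant and positive at each `B i`: the summands are nonnegative because `B i ∈
  -- C`, and not all zero by `hψ`. As a functional on `V` it shows that the open region of
  -- convergence is nonempty.
  · let L : V →ₗ[ℝ] ℝ := ∑ σ : W, ψ ∘ₗ (σ : V ≃ₗᵢ[ℝ] V).toLinearEquiv.toLinearMap
    have hL : ∀ x, L x = ψ (∑ σ : W, (σ : V ≃ₗᵢ[ℝ] V) x) := fun x => by
      rw [map_sum, LinearMap.sum_apply]
      rfl
    have hLinv : ∀ σ ∈ W, ∀ x, L (σ x) = L x := fun σ hσ x => by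
      rw [hL, hL]
      exact congrArg ψ (Equiv.sum_comp (Equiv.mulRight (⟨σ, hσ⟩ : W))
        fun τ : W => (τ : V ≃ₗᵢ[ℝ] V) x)
    have hLpos : ∀ i, 0 < L (B i) := fun i => by
      have hmem : ∀ σ ∈ W, 0 ≤ ψ (σ (B i)) := by
        have := (h.basis_mem i).1.1
        rwa [hC] at this
      rw [hL, map_sum]
      refine Finset.sum_pos' (fun σ _ => hmem σ σ.2) ?_
      by_contra! hcon
      exact B.ne_zero i (hψ _ fun σ hσ =>
        le_antisymm (hcon ⟨σ, hσ⟩ (Finset.mem_univ _)) (hmem σ hσ))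
    refine ⟨{φ | ∀ i : W × Fin (r + 1), 0 < (φ ((i.1 : V ≃ₗᵢ[ℝ] V) (B i.2))).re}, ?_,
      ⟨Complex.ofRealCLM.comp (LinearMap.toContinuousLinearMap L), fun i => ?_⟩,
      fun φ hφ => h.hasSum_cexp hs hΓ hinv fun σ hσ i => hφ (⟨σ, hσ⟩, i)⟩
    · rw [Set.ofPred_forall]
      exact isOpen_iInter_of_finite fun i =>
        isOpen_lt continuous_const (Complex.continuous_re.comp (by fun_prop))
    · change 0 < ((L ((i.1 : V ≃ₗᵢ[ℝ] V) (B i.2)) : ℝ) : ℂ).re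
      rw [Complex.ofReal_re, hLinv _ i.1.2]
      exact hLpos i.2

end IsAdaptedBasis

end GeneratingFunction

end SymCone

theorem mainTheorem1 {V : Type*} [NormedAddCommGroup V] [InnerProductSpace ℝ V]
    [FiniteDimensional ℝ V]
    -- an almost irreducible finite reflection group
    (W : Subgroup (V ≃ₗᵢ[ℝ] V)) [Fintype W] (hW : SymCone.IsReflectionGroup W)
    (V₁ V₂ : Submodule ℝ V) (hirr : SymCone.IsAlmostIrreducible W V₁ V₂)
    -- a `W`-invariant lattice
    (Γ : Submodule ℤ V) [DiscreteTopology Γ] [IsZLattice ℝ Γ]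
    (hΓ : ∀ σ ∈ W, ∀ x ∈ Γ, σ x ∈ Γ)
    -- a monoconditional symmetric cone and a fundamental domain
    (C : Set V) (hC : SymCone.IsMonoconditional W V₁ V₂ C)
    (F : Set V) (hF : SymCone.IsFundamentalDomain W F)
    -- an enumeration of the facet hyperplanes of the fundamental domain
    {r : ℕ} (H : Fin r → Submodule ℝ V) (hH : Function.Injective H)
    (hHF : Set.range H = {L | SymCone.IsFacetHyperplane F L})
    (hu : SymCone.IsUnimodularCone Γ (C ∩ F)) :
    (∃! b : Fin (r + 1) → V,
      SymCone.IsPrimitiveGenerators Γ (C ∩ F) b ∧ ∀ j : Fin r, b j.castSucc ∉ H j) ∧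
    ∀ b : Fin (r + 1) → V,
      SymCone.IsPrimitiveGenerators Γ (C ∩ F) b → (∀ j : Fin r, b j.castSucc ∉ H j) →
      SymCone.IsGeneratingFunction Γ C (fun φ =>
        ∑ σ : W,
          (∏ j ∈ SymCone.rightDescents (fun i => (H i).reflection) (σ : V ≃ₗᵢ[ℝ] V),
              Complex.exp (-φ ((σ : V ≃ₗᵢ[ℝ] V) (b j.castSucc)))) /
            ∏ j : Fin (r + 1),
              (1 - Complex.exp (-φ ((σ : V ≃ₗᵢ[ℝ] V) (b j))))) := by
  obtain ⟨ψ, hψ₁, ⟨v, hv, hψv⟩, hCψ, hCF⟩ := hC.exists_form hirr hF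
  obtain ⟨p, hp⟩ := hF.exists_mem_interior
  have hfix : ∀ σ ∈ W, σ v = v := fun σ hσ => hirr.trivial σ hσ v hv
  refine ⟨?_, fun b hb hbH => ?_⟩
  · obtain ⟨b, hb, hbH⟩ := hu.exists_primitiveGenerators hF hfix hψv hCF hH hHF
    refine ⟨b, ⟨hb, hbH⟩, fun b' hb' => funext fun i => ?_⟩
    obtain ⟨B, hB, hadapted⟩ := hb.exists_adaptedBasis hF hp hfix hψv hCF hH hHF hbH
    obtain ⟨B', hB', hadapted'⟩ :=
      hb'.1.exists_adaptedBasis hF hp hfix hψv hCF hH hHF hb'.2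
    rw [← hB, ← hB', hadapted.basis_eq hadapted']
  · obtain ⟨B, hB, hadapted⟩ := hb.exists_adaptedBasis hF hp hfix hψv hCF hH hHF hbH
    obtain rfl : (fun i => B i) = b := funext hB
    exact hadapted.isGeneratingFunction (hadapted.isSimpleSystem hF hp hHF) hΓ hCψ
      fun x hx => hirr.eq_zero_of_forall_apply_eq_zero hψ₁ hv hψv.ne' hx
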